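/- Theorem 4.2. *Setting.* Let $J\in\mathbb N$ and let $X^j=(X^j(1),X^j(2),\dots)$, $j\in[J]=\{1,\dots,J\}$, be independent data streams. Stream $j$ has law $\mathsf P^j_0$ (noise) or $\mathsf P^j_1$ (signal); $\mathsf P_A$ is the product law, with expectation $\mathsf E_A$, when $A\subset[J]$ is the set of streams with signal. For every $n$, $\mathsf P^j_0$ and $\mathsf P^j_1$ are mutually absolutely continuous on $\sigma(X^j(1),\dots,X^j(n))$, with log-likelihood ratio (LLR) $\lambda^j(n)=\log\frac{d\mathsf P^j_1}{d\mathsf P^j_0}$ there. $\mathcal F_n$ is generated by the first $n$ observations of all streams. Fix integers $k_1,k_2\ge1$ with $k_1+k_2\le J$. For $\alpha,\beta\in(0,1)$, $\Delta_{k_1,k_2}(\alpha,\beta)$ is the class of pairs $(T,D)$, where $T$ is an $\{\mathcal F_n\}$-stopping time with values in $\{1,2,\dots\}\cup\{\infty\}$ and $D\subset[J]$ is $\mathcal F_T$-measurable, such that for all $A\subset[J]$, $\mathsf P_A(|D\setminus A|\ge k_1)\le\alpha$ and $\mathsf P_A(|A\setminus D|\ge k_2)\le\beta$. Put $N^*_A(k_1,k_2,\alpha,\beta)=\inf_{(T,D)\in\Delta_{k_1,k_2}(\alpha,\beta)}\mathsf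 E_A[T]$. *Leap rule.* Let $\widehat\lambda^1(n)\le\dots\le\widehat\lambda^{p(n)}(n)$ be the ordered positive LLRs at time $n$, in streams $\widehat i_1(n),\dots,\widehat i_{p(n)}(n)$, and $\widecheck\lambda^1(n)\le\dots\le\widecheck\lambda^{q(n)}(n)$ the ordered absolute values of the non-positive LLRs, in streams $\widecheck i_1(n),\dots,\widecheck i_{q(n)}(n)$ (ties broken by the stream index); put $\widehat\lambda^i(n)=\infty$ for $i>p(n)$ and $\widecheck\lambda^i(n)=\infty$ for $i>q(n)$. For real thresholds $a,b$ let $$\widehat\tau_\ell=\inf\Big\{n\ge1:\sum_{i=1}^{k_1-\ell}\widehat\lambda^i(n)\ge b,\ \sum_{i=\ell+1}^{\ell+k_2}\widecheck\lambda^i(n)\ge a\Big\}\ (0\le\ell<k_1),$$ $$\widecheck\tau_\ell=\inf\Big\{n\ge1:\sum_{i=\ell+1}^{\ell+k_1}\widehat\lambda^i(n)\ge b,\ \sum_{i=1}^{k_2-\ell}\widecheck\lambda^i(n)\ge a\Big\}\ (1\le\ell<k_2).$$ Let $\widehat D_\ell$ consist of all streams with positive LLR at time $\widehat\tau_\ell$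 together with $\widecheck i_1,\dots,\widecheck i_\ell$ (those that exist), and let $\widecheck D_\ell$ consist of all streams with positive LLR at time $\widecheck\tau_\ell$ except $\widehat i_1,\dots,\widehat i_\ell$. The Leap rule is $\delta_L=(T_L,D_L)$, where $T_L=\min\{\min_{0\le\ell<k_1}\widehat\tau_\ell,\ \min_{1\le\ell<k_2}\widecheck\tau_\ell\}$ and $D_L$ is the union of those $\widehat D_\ell$ ($0\le\ell<k_1$) with $\widehat\tau_\ell=T_L$ and those $\widecheck D_\ell$ ($1\le\ell<k_2$) with $\widecheck\tau_\ell=T_L$ (and $D_L=\emptyset$ if $T_L=\infty$). *Assumptions.* There are numbers $\mathcal I^j_0,\mathcal I^j_1\in(0,\infty)$ such that for every $j\in[J]$ at least one of the following holds: (i) $\lambda^j$ (with $\lambda^j(0)=0$) has i.i.d. increments under each of $\mathsf P^j_0,\mathsf P^j_1$, and $\lambda^j(n)/n\to\mathcal I^j_1$ $\mathsf P^j_1$-a.s., $\lambda^j(n)/n\to-\mathcal I^j_0$ $\mathsf P^j_0$-a.s.; (ii) for every $\epsilon>0$, $\sum_{n\ge1}\mathsf P^j_1(|\lambda^j(n)/n-\mathcal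 I^j_1|>\epsilon)<\infty$ and $\sum_{n\ge1}\mathsf P^j_0(|\lambda^j(n)/n+\mathcal I^j_0|>\epsilon)<\infty$. *Limit.* For $B\subset[J]$, $i\in\{0,1\}$ and $1\le\ell\le u$ let $\mathcal D_i(B;\ell,u)=\sum_{m=\ell}^{u}\mathcal I_i^{(m)}(B)$, where $\mathcal I_i^{(m)}(B)$ is the $m$-th smallest of the $\mathcal I^j_i$, $j\in B$, and $\mathcal I_i^{(m)}(B)=\infty$ if $m>|B|$. With $c/\infty=0$ and $A^c=[J]\setminus A$, let $$\widehat L_A(\ell)=\max\Big\{\tfrac{|\log\alpha|}{\mathcal D_1(A;1,k_1-\ell)},\tfrac{|\log\beta|}{\mathcal D_0(A^c;\ell+1,\ell+k_2)}\Big\},\quad \widecheck L_A(\ell)=\max\Big\{\tfrac{|\log\alpha|}{\mathcal D_1(A;\ell+1,\ell+k_1)},\tfrac{|\log\beta|}{\mathcal D_0(A^c;1,k_2-\ell)}\Big\},$$ $$L_A(k_1,k_2,\alpha,\beta)=\min\Big\{\min_{0\le\ell<k_1}\widehat L_A(\ell),\ \min_{0\le\ell<k_2}\widecheck L_A(\ell)\Big\}.$$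 *Conclusion.* Let the thresholds $a=a(\alpha,\beta)$, $b=b(\alpha,\beta)$ be such that $\delta_L\in\Delta_{k_1,k_2}(\alpha,\beta)$ for all sufficiently small $\alpha,\beta>0$, and $a/|\log\beta|\to1$, $b/|\log\alpha|\to1$ as $\alpha,\beta\to0$. Then for every $A\subset[J]$, $$\mathsf E_A[T_L]\ \sim\ L_A(k_1,k_2,\alpha,\beta)\ \sim\ N^*_A(k_1,k_2,\alpha,\beta)\qquad\text{as }\alpha,\beta\to0,$$ where $x\sim y$ means $x/y\to1$ and the limit $(\alpha,\beta)\to(0,0)$, $\alpha,\beta>0$, is taken jointly, with no restriction on the relative rates. In particular the Leap rule is asymptotically optimal. -/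

import Mathlib

open MeasureTheory ProbabilityTheory Filter Topology
open scoped ENNReal

noncomputable section

namespace GFWER

/-! ### Order statistics -/

/-- The `i`-th smallest value (`i = 1, 2, …`, counted with multiplicity) of the family
`(v j)_{j ∈ S}`: the least `t` such that at least `i` of the values are `≤ t`.
It is `∞` when `i > |S|`. -/
def orderStat {J : ℕ} (S : Finset (Fin J)) (v : Fin J → ℝ≥0∞) (i : ℕ) : ℝ≥0∞ :=
  sInf {t : ℝ≥0∞ | i ≤ (S.filter fun j => v j ≤ t).card}

/-- The indices of the `m` smallest values of `(v j)_{j ∈ S}` (all of `S` if `m ≥ |S|`);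
ties are broken in favour of the smaller index. -/
def leastIndices {J : ℕ} (S : Finset (Fin J)) (v : Fin J → ℝ≥0∞) (m : ℕ) : Finset (Fin J) :=
  S.filter fun j => (S.filter fun i => v i < v j ∨ (v i = v j ∧ i < j)).card < m

/-! ### One data stream -/

section Stream

variable {E : Type*} [MeasurableSpace E]

/-- The first `n` observations `X(1), …, X(n)` of a stream (`X(i + 1)` is `x i`). -/
def firstObs (n : ℕ) (x : ℕ → E) : Fin n → E := fun i => x i

/-- The log-likelihood ratio `λ(n) = log (dP₁/dP₀)` for the first `n` observations. -/
def logLR (P₀ P₁ : Measure (ℕ → E)) (n : ℕ) (x : ℕ → E) : ℝ :=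
  llr (P₁.map (firstObs n)) (P₀.map (firstObs n)) (firstObs n x)

/-- `P₀` and `P₁` are mutually absolutely continuous when restricted to the
σ-algebra of the first `n` observations, for every `n`. -/
def LocallyEquivalent (P₀ P₁ : Measure (ℕ → E)) : Prop :=
  ∀ n : ℕ, P₁.map (firstObs n) ≪ P₀.map (firstObs n) ∧
    P₀.map (firstObs n) ≪ P₁.map (firstObs n)

/-- Under `Q`, the process `λ(n)`, `n ≥ 1`, with `λ(0) = 0`, has independent and identically
distributed increments (`λ(0)` is the logarithm of a ratio of probability measures on a
one-point space). -/
def HasIIDIncrements (P₀ P₁ Q : Measure (ℕ → E)) : Prop :=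
  iIndepFun (fun (n : ℕ) (x : ℕ → E) => logLR P₀ P₁ (n + 1) x - logLR P₀ P₁ n x) Q ∧
    ∀ n : ℕ, IdentDistrib (fun x : ℕ → E => logLR P₀ P₁ (n + 1) x - logLR P₀ P₁ n x)
      (fun x : ℕ → E => logLR P₀ P₁ 1 x - logLR P₀ P₁ 0 x) Q Q

/-- Strong law of large numbers: `λ(n)/n → I₁` a.s. under `P₁`, `λ(n)/n → -I₀` a.s. under `P₀`. -/
def SLLN (P₀ P₁ : Measure (ℕ → E)) (I₀ I₁ : ℝ) : Prop :=
  (∀ᵐ x ∂P₁, Tendsto (fun n : ℕ => logLR P₀ P₁ n x / n) atTop (𝓝 I₁)) ∧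
    (∀ᵐ x ∂P₀, Tendsto (fun n : ℕ => logLR P₀ P₁ n x / n) atTop (𝓝 (-I₀)))

/-- Complete convergence of `λ(n)/n` to `I₁` under `P₁` and to `-I₀` under `P₀`
(the sums run over the times `n + 1 = 1, 2, …`). -/
def CompleteSLLN (P₀ P₁ : Measure (ℕ → E)) (I₀ I₁ : ℝ) : Prop :=
  ∀ ε : ℝ, 0 < ε →
    (∑' n : ℕ, P₁ {x | ε < |logLR P₀ P₁ (n + 1) x / ((n + 1 : ℕ) : ℝ) - I₁|} < ∞) ∧
    (∑' n : ℕ, P₀ {x | ε < |logLR P₀ P₁ (n + 1) x / ((n + 1 : ℕ) : ℝ) + I₀|} < ∞)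

/-- The distributional assumption on a stream: either the log-likelihood ratio has i.i.d.
increments and satisfies the strong law of large numbers, or it satisfies the
strong law with complete convergence. -/
def StreamAssumption (P₀ P₁ : Measure (ℕ → E)) (I₀ I₁ : ℝ) : Prop :=
  (HasIIDIncrements P₀ P₁ P₀ ∧ HasIIDIncrements P₀ P₁ P₁ ∧ SLLN P₀ P₁ I₀ I₁) ∨
    CompleteSLLN P₀ P₁ I₀ I₁

end Stream

/-! ### Sequential multiple testing -/

section Testing

variable {J : ℕ} {E : Fin J → Type*} [∀ j, MeasurableSpace (E j)]

/-- `P_A`: the streams are independent, with law `P₁ j` for `j ∈ A` and `P₀ j` for `j ∉ A`. -/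
def signalLaw (P₀ P₁ : ∀ j, Measure (ℕ → E j)) (A : Finset (Fin J)) :
    Measure (∀ j, ℕ → E j) :=
  Measure.pi fun j => if j ∈ A then P₁ j else P₀ j

/-- The filtration `𝓕 n` generated by the first `n` observations in all streams. -/
def obsFiltration (E : Fin J → Type*) [∀ j, MeasurableSpace (E j)] :
    Filtration ℕ (MeasurableSpace.pi : MeasurableSpace (∀ j, ℕ → E j)) where
  seq n := MeasurableSpace.comap (fun (ω : ∀ j, ℕ → E j) (j : Fin J) => firstObs n (ω j))
    MeasurableSpace.pi
  mono' := by
    intro m n hmn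
    refine Measurable.comap_le ?_
    have h : (fun (ω : ∀ j, ℕ → E j) (j : Fin J) => firstObs m (ω j)) =
        (fun (y : ∀ j, Fin n → E j) (j : Fin J) (i : Fin m) => y j (Fin.castLE hmn i)) ∘
          fun (ω : ∀ j, ℕ → E j) (j : Fin J) => firstObs n (ω j) := rfl
    rw [h]
    refine Measurable.comp ?_ (comap_measurable _)
    fun_prop
  le' := by
    intro n
    refine Measurable.comap_le ?_
    unfold firstObs
    fun_prop

/-- A sequential multiple testing procedure: `T` is a stopping time with values in
`{1, 2, …} ∪ {∞}` and the set `D` of rejected nulls is `𝓕_T`-measurable. -/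
def IsProcedure (T : (∀ j, ℕ → E j) → ℕ∞) (D : (∀ j, ℕ → E j) → Finset (Fin J)) : Prop :=
  (∀ ω, 1 ≤ T ω) ∧
    ∃ hT : IsStoppingTime (ι := ℕ) (obsFiltration E) T,
      ∀ j : Fin J, MeasurableSet[hT.measurableSpace] {ω | j ∈ D ω}

/-- `(T, D) ∈ Δ_{k₁,k₂}(α, β)`: whatever the set `A` of signals, the probability of at least
`k₁` false positives is at most `α` and that of at least `k₂` false negatives is at most `β`. -/
def InClass (P₀ P₁ : ∀ j, Measure (ℕ → E j)) (k₁ k₂ : ℕ) (α β : ℝ)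
    (T : (∀ j, ℕ → E j) → ℕ∞) (D : (∀ j, ℕ → E j) → Finset (Fin J)) : Prop :=
  IsProcedure T D ∧ ∀ A : Finset (Fin J),
    signalLaw P₀ P₁ A {ω | k₁ ≤ (D ω \ A).card} ≤ ENNReal.ofReal α ∧
    signalLaw P₀ P₁ A {ω | k₂ ≤ (A \ D ω).card} ≤ ENNReal.ofReal β

/-- The expected sample size `E_A[T]`. -/
def expectedSize (P₀ P₁ : ∀ j, Measure (ℕ → E j)) (A : Finset (Fin J))
    (T : (∀ j, ℕ → E j) → ℕ∞) : ℝ≥0∞ :=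
  ∫⁻ ω, ((T ω : ℕ∞) : ℝ≥0∞) ∂(signalLaw P₀ P₁ A)

/-- The optimal expected sample size `N*_A(k₁, k₂, α, β)`. -/
def optimalSize (P₀ P₁ : ∀ j, Measure (ℕ → E j)) (k₁ k₂ : ℕ) (A : Finset (Fin J))
    (α β : ℝ) : ℝ≥0∞ :=
  ⨅ (T : (∀ j, ℕ → E j) → ℕ∞) (D : (∀ j, ℕ → E j) → Finset (Fin J))
    (_ : InClass P₀ P₁ k₁ k₂ α β T D), expectedSize P₀ P₁ A T

/-! ### The Leap rule -/

/-- The vector `(λ¹(n), …, λᴶ(n))` of local log-likelihood ratios at time `n`. -/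
def llrVec (P₀ P₁ : ∀ j, Measure (ℕ → E j)) (n : ℕ) (ω : ∀ j, ℕ → E j) : Fin J → ℝ :=
  fun j => logLR (P₀ j) (P₁ j) n (ω j)

/-- The streams with a positive log-likelihood ratio. -/
def posStreams (x : Fin J → ℝ) : Finset (Fin J) := Finset.univ.filter fun j => 0 < x j

/-- The streams with a non-positive log-likelihood ratio. -/
def negStreams (x : Fin J → ℝ) : Finset (Fin J) := Finset.univ.filter fun j => x j ≤ 0

/-- Sum of the `ℓ`-th to the `u`-th least significant positive log-likelihood ratios
(`∞` if there are fewer than `u` of them). -/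
def posSum (x : Fin J → ℝ) (ℓ u : ℕ) : ℝ≥0∞ :=
  ∑ i ∈ Finset.Icc ℓ u, orderStat (posStreams x) (fun j => ENNReal.ofReal (x j)) i

/-- Sum of the absolute values of the `ℓ`-th to the `u`-th least significant non-positive
log-likelihood ratios (`∞` if there are fewer than `u` of them). -/
def negSum (x : Fin J → ℝ) (ℓ u : ℕ) : ℝ≥0∞ :=
  ∑ i ∈ Finset.Icc ℓ u, orderStat (negStreams x) (fun j => ENNReal.ofReal (-x j)) i

/-- The stopping time `τ̂_ℓ`. -/
def tauHat (P₀ P₁ : ∀ j, Measure (ℕ → E j)) (k₁ k₂ : ℕ) (a b : ℝ) (ℓ : ℕ)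
    (ω : ∀ j, ℕ → E j) : ℕ∞ :=
  ⨅ (n : ℕ) (_ : 1 ≤ n ∧ ENNReal.ofReal b ≤ posSum (llrVec P₀ P₁ n ω) 1 (k₁ - ℓ) ∧
    ENNReal.ofReal a ≤ negSum (llrVec P₀ P₁ n ω) (ℓ + 1) (ℓ + k₂)), (n : ℕ∞)

/-- The stopping time `τ̌_ℓ`. -/
def tauCheck (P₀ P₁ : ∀ j, Measure (ℕ → E j)) (k₁ k₂ : ℕ) (a b : ℝ) (ℓ : ℕ)
    (ω : ∀ j, ℕ → E j) : ℕ∞ :=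
  ⨅ (n : ℕ) (_ : 1 ≤ n ∧ ENNReal.ofReal b ≤ posSum (llrVec P₀ P₁ n ω) (ℓ + 1) (ℓ + k₁) ∧
    ENNReal.ofReal a ≤ negSum (llrVec P₀ P₁ n ω) 1 (k₂ - ℓ)), (n : ℕ∞)

/-- The decision of `δ̂_ℓ` from the log-likelihood ratios at its stopping time: reject where
they are positive, and also in the `ℓ` streams with least significant non-positive ones. -/
def rejectHat (x : Fin J → ℝ) (ℓ : ℕ) : Finset (Fin J) :=
  posStreams x ∪ leastIndices (negStreams x) (fun j => ENNReal.ofReal (-x j)) ℓ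

/-- The decision of `δ̌_ℓ` from the log-likelihood ratios at its stopping time: reject where
they are positive, except in the `ℓ` streams with least significant positive ones. -/
def rejectCheck (x : Fin J → ℝ) (ℓ : ℕ) : Finset (Fin J) :=
  posStreams x \ leastIndices (posStreams x) (fun j => ENNReal.ofReal (x j)) ℓ

/-- The stopping time `T_L` of the Leap rule. -/
def leapTime (P₀ P₁ : ∀ j, Measure (ℕ → E j)) (k₁ k₂ : ℕ) (a b : ℝ)
    (ω : ∀ j, ℕ → E j) : ℕ∞ :=
  min (⨅ ℓ ∈ Finset.Ico 0 k₁, tauHat P₀ P₁ k₁ k₂ a b ℓ ω)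
    (⨅ ℓ ∈ Finset.Ico 1 k₂, tauCheck P₀ P₁ k₁ k₂ a b ℓ ω)

/-- The decision `D_L` of the Leap rule (the empty set if the rule never stops). -/
def leapDecision (P₀ P₁ : ∀ j, Measure (ℕ → E j)) (k₁ k₂ : ℕ) (a b : ℝ)
    (ω : ∀ j, ℕ → E j) : Finset (Fin J) :=
  if leapTime P₀ P₁ k₁ k₂ a b ω = ⊤ then ∅
  else
    (((Finset.Ico 0 k₁).filter fun ℓ =>
        tauHat P₀ P₁ k₁ k₂ a b ℓ ω = leapTime P₀ P₁ k₁ k₂ a b ω).biUnion fun ℓ =>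
      rejectHat (llrVec P₀ P₁ (leapTime P₀ P₁ k₁ k₂ a b ω).toNat ω) ℓ) ∪
    (((Finset.Ico 1 k₂).filter fun ℓ =>
        tauCheck P₀ P₁ k₁ k₂ a b ℓ ω = leapTime P₀ P₁ k₁ k₂ a b ω).biUnion fun ℓ =>
      rejectCheck (llrVec P₀ P₁ (leapTime P₀ P₁ k₁ k₂ a b ω).toNat ω) ℓ)

end Testing

/-! ### The limiting performance -/

/-- `𝓓(B; ℓ, u)`: the sum of the `ℓ`-th to the `u`-th smallest of the numbers `I j`, `j ∈ B`
(`∞` if `u > |B|`). -/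
def infoSum {J : ℕ} (I : Fin J → ℝ) (B : Finset (Fin J)) (ℓ u : ℕ) : ℝ≥0∞ :=
  ∑ i ∈ Finset.Icc ℓ u, orderStat B (fun j => ENNReal.ofReal (I j)) i

/-- `L̂_A(ℓ; α, β)`, with `c / ∞ = 0`. -/
def LHat {J : ℕ} (I₀ I₁ : Fin J → ℝ) (k₁ k₂ : ℕ) (A : Finset (Fin J)) (α β : ℝ)
    (ℓ : ℕ) : ℝ≥0∞ :=
  max (ENNReal.ofReal |Real.log α| / infoSum I₁ A 1 (k₁ - ℓ))
    (ENNReal.ofReal |Real.log β| / infoSum I₀ Aᶜ (ℓ + 1) (ℓ + k₂))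

/-- `Ľ_A(ℓ; α, β)`, with `c / ∞ = 0`. -/
def LCheck {J : ℕ} (I₀ I₁ : Fin J → ℝ) (k₁ k₂ : ℕ) (A : Finset (Fin J)) (α β : ℝ)
    (ℓ : ℕ) : ℝ≥0∞ :=
  max (ENNReal.ofReal |Real.log α| / infoSum I₁ A (ℓ + 1) (ℓ + k₁))
    (ENNReal.ofReal |Real.log β| / infoSum I₀ Aᶜ 1 (k₂ - ℓ))

/-- `L_A(k₁, k₂, α, β)`. -/
def limitSize {J : ℕ} (I₀ I₁ : Fin J → ℝ) (k₁ k₂ : ℕ) (A : Finset (Fin J))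
    (α β : ℝ) : ℝ≥0∞ :=
  min (⨅ ℓ ∈ Finset.Ico 0 k₁, LHat I₀ I₁ k₁ k₂ A α β ℓ)
    (⨅ ℓ ∈ Finset.Ico 0 k₂, LCheck I₀ I₁ k₁ k₂ A α β ℓ)

/-- The passage `α, β → 0` through positive values, at arbitrary rates. -/
def toZero : Filter (ℝ × ℝ) := 𝓝[>] (0 : ℝ) ×ˢ 𝓝[>] (0 : ℝ)

end GFWER

end

namespace GFWER

/-! ### Elementary facts on log-likelihood ratios -/

section LogLR

variable {E : Type*} [MeasurableSpace E]

/-! Both equivalences come from a squeeze. For every ε and all small α, β, each procedure in the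
class has E_A[T] ≥ (1 - ε) L_A (`eventually_le_expectedSize`), and the Leap rule has E_A[T_L] ≤ (1 +
ε) L_A (`eventually_expectedSize_leapTime_le`). Since the Leap rule lies in the class, N*_A is
caught between the same bounds.

Lower bound: let D = B with s = |B \ A| < k₁ and r = |A \ B| < k₂. If k₁ - s streams U ⊆ A ∩ B
carried no signal, B would contain k₁ false positives, so D = B has probability at most α under the
signal set A \ U. The log-likelihood ratio of P_A against P_{A \ U} grows at rate ∑_U I₁, and a
change of measure makes D = B unlikely under P_A before time (1 - ε)|log α| / ∑_U I₁. At most r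
streams of A are missing from B, so the cheapest U costs at most 𝓓₁(A; r + 1, r + k₁ - s). Adding k₂
- r signals outside A ∪ B gives the analogue for β. The larger of the two limiting times is at least
L_A, and there are finitely many B.

Upper bound: just past any term of L_A, the rule stops as soon as every log-likelihood ratio has
covered a fraction 1 - ε of its drift. The probabilities that some stream fails to do so are
summable in time, so the expected delay is bounded, hence negligible because L_A → ∞ when k₁ + k₂ ≤
J. For i.i.d. increments the summability is a Chernoff bound, available because exp(-λ) has mean at
most one under P₁. -/

lemma measurable_firstObs (n : ℕ) : Measurable (firstObs (E := E) n) := by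
  unfold firstObs
  fun_prop

lemma measurable_logLR (P₀ P₁ : Measure (ℕ → E)) (n : ℕ) : Measurable (logLR P₀ P₁ n) :=
  (measurable_llr _ _).comp (measurable_firstObs n)

lemma LocallyEquivalent.symm {P₀ P₁ : Measure (ℕ → E)} (h : LocallyEquivalent P₀ P₁) :
    LocallyEquivalent P₁ P₀ := fun n => (h n).symm

instance isProbabilityMeasure_map_firstObs (P : Measure (ℕ → E)) [IsProbabilityMeasure P] (n : ℕ) :
    IsProbabilityMeasure (P.map (firstObs n)) :=
  Measure.isProbabilityMeasure_map (measurable_firstObs n).aemeasurable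

variable {P₀ P₁ : Measure (ℕ → E)} [IsProbabilityMeasure P₀] [IsProbabilityMeasure P₁]

/-- There is a single empty observation vector, so both marginals are the same point mass. An almost
sure identity on a one-point space holds everywhere. -/
lemma logLR_zero (x : ℕ → E) : logLR P₀ P₁ 0 x = 0 := by
  have hμ : P₁.map (firstObs 0) = P₀.map (firstObs 0) := by
    ext s -
    rcases s.eq_empty_or_nonempty with rfl | hs
    · simp
    · rw [Subsingleton.eq_univ_of_nonempty hs, measure_univ, measure_univ]
  unfold logLR
  rw [hμ]
  obtain ⟨y, hy⟩ := (llr_self (P₀.map (firstObs 0))).exists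
  rwa [Subsingleton.elim (firstObs 0 x) y]

lemma logLR_swap (h : LocallyEquivalent P₀ P₁) (n : ℕ) :
    logLR P₁ P₀ n =ᵐ[P₁] fun x => -logLR P₀ P₁ n x := by
  have := ae_of_ae_map (measurable_firstObs n).aemeasurable
    (neg_llr (h n).1)
  filter_upwards [this] with x hx
  exact hx.symm

lemma logLR_swap' (h : LocallyEquivalent P₀ P₁) (n : ℕ) :
    logLR P₁ P₀ n =ᵐ[P₀] fun x => -logLR P₀ P₁ n x := by
  filter_upwards [logLR_swap h.symm n] with x hx
  rw [hx, neg_neg]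

lemma logLR_self (n : ℕ) : logLR P₀ P₀ n =ᵐ[P₀] 0 := by
  filter_upwards [ae_of_ae_map (measurable_firstObs n).aemeasurable
    (llr_self (P₀.map (firstObs n)))] with x hx
  exact hx

/-- Under P₁, exp(-λ(n)) is the density of P₀ on the first n observations. This is the only
exponential moment at hand. -/
lemma lintegral_exp_neg_logLR_le (h : LocallyEquivalent P₀ P₁) (n : ℕ) :
    ∫⁻ x, ENNReal.ofReal (Real.exp (-logLR P₀ P₁ n x)) ∂P₁ ≤ 1 := by
  have h1 : ∫⁻ x, ENNReal.ofReal (Real.exp (-logLR P₀ P₁ n x)) ∂P₁ =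
      ∫⁻ y, ENNReal.ofReal (Real.exp (-llr (P₁.map (firstObs n)) (P₀.map (firstObs n)) y))
        ∂(P₁.map (firstObs n)) := by
    rw [lintegral_map _ (measurable_firstObs n)]
    · rfl
    · fun_prop
  rw [h1]
  calc _ = ∫⁻ y, (P₀.map (firstObs n)).rnDeriv (P₁.map (firstObs n)) y
        ∂(P₁.map (firstObs n)) := by
        refine lintegral_congr_ae ?_
        filter_upwards [exp_neg_llr (h n).1,
          Measure.rnDeriv_lt_top (P₀.map (firstObs n)) (P₁.map (firstObs n))] with y hy hy'
        rw [hy, ENNReal.ofReal_toReal hy'.ne]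
    _ ≤ P₀.map (firstObs n) Set.univ := Measure.lintegral_rnDeriv_le
    _ = 1 := measure_univ

end LogLR

/-! ### Deviations of processes that satisfy a law of large numbers -/

section Deviation

variable {Ω : Type*} [MeasurableSpace Ω] {Q : Measure Ω} [IsProbabilityMeasure Q]

lemma tendsto_measure_zero_of_ae_eventually {ι : Type*} {L : Filter ι} [L.IsCountablyGenerated]
    {s : ι → Set Ω} (hs : ∀ i, MeasurableSet (s i)) (h : ∀ᵐ ω ∂Q, ∀ᶠ i in L, ω ∉ s i) :
    Tendsto (fun i => Q (s i)) L (𝓝 0) := by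
  rw [← measure_empty (μ := Q)]
  refine tendsto_measure_of_ae_tendsto_indicator_of_isFiniteMeasure L MeasurableSet.empty hs ?_
  filter_upwards [h] with ω hω
  filter_upwards [hω] with i hi
  simpa using hi

/-- The maximum of a process up to time `q` rarely exceeds `c q` if `c` is larger than its rate
of growth. -/
lemma tendsto_measure_exists_ge {f : ℕ → Ω → ℝ} (hf : ∀ n, Measurable (f n)) {I c : ℝ}
    (hlim : ∀ᵐ ω ∂Q, Tendsto (fun n : ℕ => f n ω / n) atTop (𝓝 I)) (hc : 0 < c) (hIc : I < c) :
    Tendsto (fun q : ℝ => Q {ω | ∃ n : ℕ, (n : ℝ) ≤ q ∧ c * q ≤ f n ω}) atTop (𝓝 0) := by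
  refine tendsto_measure_zero_of_ae_eventually (fun q => ?_) ?_
  · simp only [Set.ofPred_exists]
    refine MeasurableSet.iUnion fun n => ?_
    exact (MeasurableSet.const _).inter (measurableSet_le measurable_const (hf n))
  · filter_upwards [hlim] with ω hω
    -- From N on, the process stays below c n ≤ c q. The finitely many earlier values are bounded by
    -- K, which is less than c q once q > K / c.
    obtain ⟨N, hN⟩ := eventually_atTop.1 ((hω.eventually_lt_const hIc).and (eventually_gt_atTop 0))
    obtain ⟨K, hK⟩ := ((Finset.range N).image fun n => f n ω).bddAbove
    filter_upwards [eventually_gt_atTop (K / c)] with q hq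
    rintro ⟨n, hnq, hn⟩
    rcases lt_or_ge n N with h | h
    · have := hK (Finset.mem_coe.2 (Finset.mem_image_of_mem (fun n => f n ω) (Finset.mem_range.2 h)))
      rw [div_lt_iff₀ hc] at hq
      linarith [mul_comm q c]
    · obtain ⟨h1, h2⟩ := hN n h
      have hn0 : (0 : ℝ) < n := by exact_mod_cast h2
      rw [div_lt_iff₀ hn0] at h1
      nlinarith

/-- A uniform integrability estimate: the variables exp(-y / M), M ≥ 2, have squares at most 1 +
exp(-y), and u ≤ K + u² / K for every u > 0. -/
lemma exp_neg_div_le {y : ℝ} {M : ℕ} (hM : 2 ≤ M) {K : ℝ} (hK : 0 < K) :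
    Real.exp (-y / M) ≤ K + (1 + Real.exp (-y)) / K := by
  have h1 : Real.exp (-y / M) ^ 2 ≤ 1 + Real.exp (-y) := by
    have hM' : (2 : ℝ) ≤ M := by exact_mod_cast hM
    rw [← Real.exp_nat_mul]
    rcases le_total 0 y with h | h
    · have : Real.exp (((2 : ℕ) : ℝ) * (-y / M)) ≤ 1 := by
        rw [Real.exp_le_one_iff]
        have : 0 ≤ y / M := by positivity
        push_cast
        rw [neg_div]
        linarith
      linarith [Real.exp_pos (-y)]
    · have : Real.exp (((2 : ℕ) : ℝ) * (-y / M)) ≤ Real.exp (-y) := by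
        rw [Real.exp_le_exp]
        push_cast
        rw [← mul_div_assoc, div_le_iff₀ (by linarith)]
        nlinarith
      linarith
  set u := Real.exp (-y / M)
  have hu : 0 < u := Real.exp_pos _
  rcases le_total u K with h | h
  · have : 0 ≤ (1 + Real.exp (-y)) / K := by positivity
    linarith
  · have : u ≤ (1 + Real.exp (-y)) / K := by
      rw [le_div_iff₀ hK]
      nlinarith
    linarith

/-- A process with i.i.d. increments that grows at rate `I` and whose negative has exponential
moments of order one has summable lower large deviation probabilities. -/
lemma tsum_measure_lt_of_iIndepFun {f : ℕ → Ω → ℝ} (hf : ∀ n, Measurable (f n))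
    (h0 : ∀ ω, f 0 ω = 0) (hind : iIndepFun (fun n ω => f (n + 1) ω - f n ω) Q)
    (hid : ∀ n, IdentDistrib (fun ω => f (n + 1) ω - f n ω) (fun ω => f 1 ω - f 0 ω) Q Q)
    (hexp : ∀ n, ∫⁻ ω, ENNReal.ofReal (Real.exp (-f n ω)) ∂Q ≤ 1) {I c : ℝ}
    (hlim : ∀ᵐ ω ∂Q, Tendsto (fun n : ℕ => f n ω / n) atTop (𝓝 I)) (hc : c < I) :
    ∑' n : ℕ, Q {ω | f (n + 1) ω < c * ((n + 1 : ℕ) : ℝ)} < ∞ := by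
  -- Two intermediate rates c < c' < d < I: f M exceeds d M with high probability, the gap from d to
  -- c' absorbs the exceptional event, and the gap from c' to c yields geometric decay.
  obtain ⟨c', hcc', hc'I⟩ := exists_between hc
  obtain ⟨d, hc'd, hdI⟩ := exists_between hc'I
  have hint1 : ∀ n, Integrable (fun ω => Real.exp (-f n ω)) Q := by
    intro n
    refine ⟨(hf n).neg.exp.aestronglyMeasurable, ?_⟩
    rw [hasFiniteIntegral_iff_ofReal (ae_of_all _ fun _ => (Real.exp_pos _).le)]
    exact (hexp n).trans_lt ENNReal.one_lt_top
  have hexp' : ∀ n, ∫ ω, Real.exp (-f n ω) ∂Q ≤ 1 := by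
    intro n
    rw [integral_eq_lintegral_of_nonneg_ae (ae_of_all _ fun _ => (Real.exp_pos _).le)
      (hint1 n).aestronglyMeasurable]
    exact ENNReal.toReal_le_of_le_ofReal zero_le_one (by simpa using hexp n)
  have hint : ∀ (M n : ℕ), 2 ≤ M →
      Integrable (fun ω => Real.exp ((-(1 / (M : ℝ))) * f n ω)) Q := by
    intro M n hM
    have hm : Measurable (fun ω => Real.exp ((-(1 / (M : ℝ))) * f n ω)) :=
      ((hf n).const_mul _).exp
    refine Integrable.mono' (((integrable_const 1).add (hint1 n)).div_const 1 |>.add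
      (integrable_const 1)) hm.aestronglyMeasurable (ae_of_all _ fun ω => ?_)
    rw [Real.norm_of_nonneg (Real.exp_pos _).le]
    have := exp_neg_div_le (y := f n ω) hM one_pos
    simp only [Pi.add_apply]
    rw [show -(1 / (M : ℝ)) * f n ω = -f n ω / M by ring]
    linarith
  have hprob : Tendsto (fun n : ℕ => Q.real {ω | f n ω < d * n}) atTop (𝓝 0) := by
    have : Tendsto (fun n : ℕ => Q {ω | f n ω < d * n}) atTop (𝓝 0) := by
      refine tendsto_measure_zero_of_ae_eventually
        (fun n => measurableSet_lt (hf n) measurable_const) ?_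
      filter_upwards [hlim] with ω hω
      filter_upwards [hω.eventually_const_lt hdI, eventually_gt_atTop 0] with n hn hn0
      rw [lt_div_iff₀ (by exact_mod_cast hn0)] at hn
      simpa using hn.le
    simpa [Measure.real, Function.comp_def] using (ENNReal.tendsto_toReal ENNReal.zero_ne_top).comp this
  have hgap : 0 < Real.exp (-c') - Real.exp (-d) := by
    simpa using hc'd
  set g := Real.exp (-c') - Real.exp (-d)
  -- With truncation level K = 4 / g, the exceptional event contributes at most g / 2 through K, and
  -- the term (1 + exp(-f M)) / K at most 2 / K = g / 2. The total g is exactly the distance from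
  -- exp(-d) to exp(-c').
  obtain ⟨M, hM2, hM⟩ : ∃ M : ℕ, 2 ≤ M ∧
      (4 / g) * Q.real {ω | f M ω < d * M} < g / 2 := by
    have := hprob.const_mul (4 / g)
    rw [mul_zero] at this
    obtain ⟨M, h1, h2⟩ := ((eventually_ge_atTop 2).and
      (this.eventually_lt_const (half_pos hgap))).exists
    exact ⟨M, h1, h2⟩
  have hM0 : (0 : ℝ) < M := by exact_mod_cast (by omega : 0 < M)
  set θ : ℝ := -(1 / (M : ℝ)) with hθ
  set B := {ω | f M ω < d * M} with hB
  have hBm : MeasurableSet B := measurableSet_lt (hf M) measurable_const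
  have hbound : mgf (f M) Q θ ≤ Real.exp (-c') := by
    have hK : 0 < 4 / g := by positivity
    have hi2 : Integrable (fun ω => (1 + Real.exp (-f M ω)) / (4 / g)) Q :=
      ((integrable_const 1).add (hint1 M)).div_const _
    have hi1 : Integrable (B.indicator fun _ => 4 / g) Q := (integrable_const _).indicator hBm
    calc mgf (f M) Q θ ≤ ∫ ω, (Real.exp (-d) + (B.indicator (fun _ => 4 / g) ω +
          (1 + Real.exp (-f M ω)) / (4 / g))) ∂Q := by
          refine integral_mono (hint M M hM2) ((integrable_const _).add (hi1.add hi2)) fun ω => ?_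
          have hrw : θ * f M ω = -f M ω / M := by rw [hθ]; ring
          simp only [hrw]
          by_cases hω : ω ∈ B
          · rw [Set.indicator_of_mem hω]
            linarith [exp_neg_div_le (y := f M ω) hM2 hK, Real.exp_pos (-d)]
          · rw [Set.indicator_of_notMem hω]
            have h1 : Real.exp (-f M ω / M) ≤ Real.exp (-d) := by
              rw [Real.exp_le_exp, div_le_iff₀ hM0]
              have : ¬ f M ω < d * M := hω
              linarith
            have h2 : 0 ≤ (1 + Real.exp (-f M ω)) / (4 / g) := by positivity
            linarith
      _ = Real.exp (-d) + ((4 / g) * Q.real B +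
          (1 + ∫ ω, Real.exp (-f M ω) ∂Q) / (4 / g)) := by
          rw [integral_add (integrable_const _) (by exact hi1.add hi2), integral_add hi1 hi2,
            integral_div, integral_add (integrable_const _) (hint1 M),
            integral_indicator_const _ hBm]
          simp [mul_comm]
      _ ≤ Real.exp (-d) + (g / 2 + (1 + 1) / (4 / g)) := by
          gcongr
          exact hexp' M
      _ = Real.exp (-c') := by
          have : (1 + 1 : ℝ) / (4 / g) = g / 2 := by
            field_simp
            norm_num
          rw [this]
          simp only [g]
          ring
  have hsum : ∀ n, f n = ∑ i ∈ Finset.range n, fun ω => f (i + 1) ω - f i ω := by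
    intro n
    ext ω
    rw [Finset.sum_apply, Finset.sum_range_sub (fun i => f i ω), h0, sub_zero]
  set φ := mgf (fun ω => f 1 ω - f 0 ω) Q θ
  have hpow : ∀ n, mgf (f n) Q θ = φ ^ n := by
    intro n
    rw [hsum n, hind.mgf_sum (fun i => (hf _).sub (hf _))]
    rw [Finset.prod_congr rfl fun i _ => mgf_congr_of_identDistrib _ _ (hid i) θ]
    simp [φ]
  -- By independence the bound at the single time M is a bound on the M-th power of the one-step
  -- transform, so it passes to all times.
  have hφ : φ ≤ Real.exp (-c' / M) := by
    refine le_of_pow_le_pow_left₀ (n := M) (by omega) (Real.exp_pos _).le ?_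
    rw [← hpow, ← Real.exp_nat_mul]
    rwa [mul_div_cancel₀ _ hM0.ne']
  have hφ0 : 0 ≤ φ := mgf_nonneg
  set r := Real.exp ((c - c') / M)
  have hr : r < 1 := by
    rw [Real.exp_lt_one_iff]
    exact div_neg_of_neg_of_pos (by linarith) hM0
  have hdev : ∀ n : ℕ, Q {ω | f n ω < c * n} ≤ ENNReal.ofReal (r ^ n) := by
    intro n
    rw [← ofReal_measureReal]
    refine ENNReal.ofReal_le_ofReal ?_
    have hθ0 : θ ≤ 0 := by rw [hθ]; simp
    calc Q.real {ω | f n ω < c * n} ≤ Q.real {ω | f n ω ≤ c * n} :=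
          measureReal_mono fun ω (hω : f n ω < c * n) => hω.le
      _ ≤ Real.exp (-θ * (c * n)) * mgf (f n) Q θ :=
          measure_le_le_exp_mul_mgf _ hθ0 (hint M n hM2)
      _ ≤ Real.exp (-θ * (c * n)) * Real.exp (-c' / M) ^ n := by
          rw [hpow]
          gcongr
      _ = r ^ n := by
          simp only [r]
          rw [← Real.exp_nat_mul, ← Real.exp_nat_mul, ← Real.exp_add, hθ]
          congr 1
          ring
  calc ∑' n : ℕ, Q {ω | f (n + 1) ω < c * ((n + 1 : ℕ) : ℝ)}
      ≤ ∑' n : ℕ, ENNReal.ofReal (r ^ (n + 1)) := ENNReal.tsum_le_tsum fun n => hdev (n + 1)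
    _ < ∞ := by
        have hs : Summable fun n : ℕ => r ^ (n + 1) :=
          (summable_nat_add_iff 1).2 (summable_geometric_of_lt_one (Real.exp_pos _).le hr)
        rw [← ENNReal.ofReal_tsum_of_nonneg (fun n => pow_nonneg (Real.exp_pos _).le _) hs]
        exact ENNReal.ofReal_lt_top

end Deviation

/-! ### Consequences of the distributional assumption on a stream -/

section StreamLimits

variable {E : Type*} [MeasurableSpace E] {P₀ P₁ : Measure (ℕ → E)} {I₀ I₁ : ℝ}

lemma HasIIDIncrements.swap {Q : Measure (ℕ → E)}
    (h : HasIIDIncrements P₀ P₁ Q)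
    (hQ : ∀ n, logLR P₁ P₀ n =ᵐ[Q] fun x => -logLR P₀ P₁ n x) : HasIIDIncrements P₁ P₀ Q := by
  have key : ∀ n : ℕ, (fun x => -(logLR P₀ P₁ (n + 1) x - logLR P₀ P₁ n x)) =ᵐ[Q]
      fun x => logLR P₁ P₀ (n + 1) x - logLR P₁ P₀ n x := by
    intro n
    filter_upwards [hQ n, hQ (n + 1)] with x h1 h2
    rw [h1, h2]
    ring
  have hm : ∀ n : ℕ, AEMeasurable (fun x => logLR P₁ P₀ (n + 1) x - logLR P₁ P₀ n x) Q := fun n =>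
    ((measurable_logLR _ _ _).sub (measurable_logLR _ _ _)).aemeasurable
  refine ⟨iIndepFun.congr (fun n => key n)
    (h.1.comp (fun _ => fun y : ℝ => -y) fun _ => measurable_neg), fun n => ?_⟩
  have h1 := (h.2 n).comp measurable_neg
  have e1 : IdentDistrib (fun x => logLR P₁ P₀ (n + 1) x - logLR P₁ P₀ n x)
      (fun x => -(logLR P₀ P₁ (n + 1) x - logLR P₀ P₁ n x)) Q Q :=
    (IdentDistrib.of_ae_eq (hm n) (key n).symm)
  have e2 := IdentDistrib.of_ae_eq (hm 0) (key 0).symm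
  exact (e1.trans h1).trans e2.symm

/-- Complete convergence gives almost sure convergence by Borel–Cantelli, applied along the radii 1
/ (k + 1). -/
lemma StreamAssumption.ae_tendsto (h : StreamAssumption P₀ P₁ I₀ I₁) :
    ∀ᵐ x ∂P₁, Tendsto (fun n : ℕ => logLR P₀ P₁ n x / n) atTop (𝓝 I₁) := by
  rcases h with ⟨-, -, h, -⟩ | h
  · exact h
  · have h1 : ∀ᵐ x ∂P₁, ∀ k : ℕ, ∀ᶠ n : ℕ in atTop,
        |logLR P₀ P₁ (n + 1) x / ((n + 1 : ℕ) : ℝ) - I₁| ≤ 1 / ((k : ℝ) + 1) := by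
      refine ae_all_iff.2 fun k => ?_
      filter_upwards [ae_eventually_notMem (h (1 / ((k : ℝ) + 1)) (by positivity)).1.ne] with x hx
      filter_upwards [hx] with n hn
      simpa using hn
    filter_upwards [h1] with x hx
    rw [← tendsto_add_atTop_iff_nat 1]
    rw [Metric.tendsto_nhds]
    intro ε hε
    obtain ⟨k, hk⟩ := exists_nat_one_div_lt hε
    filter_upwards [hx k] with n hn
    rw [Real.dist_eq]
    exact hn.trans_lt hk

variable [IsProbabilityMeasure P₀] [IsProbabilityMeasure P₁]

/-- Exchanging noise and signal negates the log-likelihood ratio, so facts proved under P₁ transfer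
to P₀. -/
lemma StreamAssumption.swap (h : StreamAssumption P₀ P₁ I₀ I₁) (he : LocallyEquivalent P₀ P₁) :
    StreamAssumption P₁ P₀ I₁ I₀ := by
  rcases h with ⟨h0, h1, hl1, hl0⟩ | h
  · refine Or.inl ⟨h1.swap (logLR_swap he), h0.swap (logLR_swap' he), ?_, ?_⟩
    · filter_upwards [hl0, ae_all_iff.2 (logLR_swap' he)] with x hx hx'
      simp only [hx', neg_div]
      simpa using hx.neg
    · filter_upwards [hl1, ae_all_iff.2 (logLR_swap he)] with x hx hx'
      simp only [hx', neg_div]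
      exact hx.neg
  · refine Or.inr fun ε hε => ⟨?_, ?_⟩
    · convert (h ε hε).2 using 3 with n
      refine measure_congr ?_
      filter_upwards [logLR_swap' he (n + 1)] with x hx
      refine propext ?_
      change ε < |logLR P₁ P₀ (n + 1) x / ((n + 1 : ℕ) : ℝ) - I₀| ↔
        ε < |logLR P₀ P₁ (n + 1) x / ((n + 1 : ℕ) : ℝ) + I₀|
      rw [hx, ← abs_neg, neg_sub, neg_div, sub_neg_eq_add, add_comm]
    · convert (h ε hε).1 using 3 with n
      refine measure_congr ?_
      filter_upwards [logLR_swap he (n + 1)] with x hx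
      refine propext ?_
      change ε < |logLR P₁ P₀ (n + 1) x / ((n + 1 : ℕ) : ℝ) + I₁| ↔
        ε < |logLR P₀ P₁ (n + 1) x / ((n + 1 : ℕ) : ℝ) - I₁|
      rw [hx, ← abs_neg, neg_add, neg_div, neg_neg, sub_eq_add_neg]

/-- Only the lower tail is claimed: i.i.d. increments with a finite mean need not converge
completely, but the lower tail always admits the Chernoff bound. -/
lemma StreamAssumption.tsum_measure_lt (h : StreamAssumption P₀ P₁ I₀ I₁)
    (he : LocallyEquivalent P₀ P₁) {c : ℝ} (hc : c < I₁) :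
    ∑' n : ℕ, P₁ {x | logLR P₀ P₁ (n + 1) x < c * ((n + 1 : ℕ) : ℝ)} < ∞ := by
  rcases h with ⟨-, h, hl, -⟩ | h
  · exact tsum_measure_lt_of_iIndepFun (measurable_logLR P₀ P₁) logLR_zero h.1 h.2
      (lintegral_exp_neg_logLR_le he) hl hc
  · refine lt_of_le_of_lt (ENNReal.tsum_le_tsum fun n => measure_mono ?_)
      (h ((I₁ - c) / 2) (by linarith)).1
    intro x (hx : logLR P₀ P₁ (n + 1) x < c * ((n + 1 : ℕ) : ℝ))
    change (I₁ - c) / 2 < |_|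
    rw [← div_lt_iff₀ (by positivity)] at hx
    rw [lt_abs]
    right
    linarith

end StreamLimits

/-! ### Change of measure for independent streams -/

section ChangeOfMeasure

/-- It suffices to test on rectangles, where the indicator splits into factors and the integral of
the product factorises by independence. -/
lemma pi_eq_withDensity {ι : Type*} [Fintype ι] {X : ι → Type*} [∀ i, MeasurableSpace (X i)]
    (μ ν : ∀ i, Measure (X i)) [∀ i, IsProbabilityMeasure (μ i)] [∀ i, IsProbabilityMeasure (ν i)]
    (h : ∀ i, μ i ≪ ν i) :
    Measure.pi μ = (Measure.pi ν).withDensity fun x => ∏ i, (μ i).rnDeriv (ν i) (x i) := by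
  refine Measure.pi_eq fun s hs => ?_
  rw [withDensity_apply _ (MeasurableSet.univ_pi hs),
    ← lintegral_indicator (MeasurableSet.univ_pi hs)]
  have hrw : ∀ x : ∀ i, X i, (Set.univ.pi s).indicator
      (fun x => ∏ i, (μ i).rnDeriv (ν i) (x i)) x =
      ∏ i, (s i).indicator ((μ i).rnDeriv (ν i)) (x i) := by
    intro x
    by_cases hx : x ∈ Set.univ.pi s
    · rw [Set.indicator_of_mem hx]
      exact Finset.prod_congr rfl fun i _ => (Set.indicator_of_mem (hx i (Set.mem_univ i)) _).symm
    · rw [Set.indicator_of_notMem hx]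
      obtain ⟨i, hi⟩ : ∃ i, x i ∉ s i := by simpa [Set.mem_pi] using hx
      exact (Finset.prod_eq_zero (Finset.mem_univ i) (Set.indicator_of_notMem hi _)).symm
  have hm : ∀ i, Measurable ((s i).indicator ((μ i).rnDeriv (ν i))) := fun i =>
    (Measure.measurable_rnDeriv _ _).indicator (hs i)
  simp_rw [hrw]
  rw [lintegral_prod_eq_prod_lintegral_of_indepFun Finset.univ _
    (iIndepFun_pi fun i => (hm i).aemeasurable) fun i => (hm i).comp (measurable_pi_apply i)]
  refine Finset.prod_congr rfl fun i _ => ?_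
  rw [(measurePreserving_eval ν i).lintegral_comp (hm i), lintegral_indicator (hs i),
    Measure.setLIntegral_rnDeriv (h i)]

variable {J : ℕ} {E : Fin J → Type*} [∀ j, MeasurableSpace (E j)]

/-- The first `n` observations of all streams. -/
def jointObs (n : ℕ) (ω : ∀ j, ℕ → E j) : ∀ j, Fin n → E j := fun j => firstObs n (ω j)

/-- The log-likelihood ratio of `⨂ Q j` against `⨂ R j` for the first `n` observations. -/
noncomputable def jointLR (R Q : ∀ j, Measure (ℕ → E j)) (n : ℕ) (ω : ∀ j, ℕ → E j) : ℝ :=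
  ∑ j, logLR (R j) (Q j) n (ω j)

lemma measurable_jointObs (n : ℕ) : Measurable (jointObs (E := E) n) := by
  unfold jointObs firstObs
  fun_prop

lemma measurable_jointLR (R Q : ∀ j, Measure (ℕ → E j)) (n : ℕ) : Measurable (jointLR R Q n) :=
  Finset.measurable_sum _ fun j _ => (measurable_logLR _ _ _).comp (measurable_pi_apply j)

variable (R Q : ∀ j, Measure (ℕ → E j)) [∀ j, IsProbabilityMeasure (Q j)]

lemma map_jointObs_pi (n : ℕ) :
    (Measure.pi Q).map (jointObs n) = Measure.pi fun j => (Q j).map (firstObs n) :=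
  (Measure.pi_map_pi fun _ => (measurable_firstObs n).aemeasurable)

lemma ae_tendsto_jointLR {K : Fin J → ℝ}
    (hK : ∀ j, ∀ᵐ x ∂(Q j), Tendsto (fun n : ℕ => logLR (R j) (Q j) n x / n) atTop (𝓝 (K j))) :
    ∀ᵐ ω ∂(Measure.pi Q), Tendsto (fun n : ℕ => jointLR R Q n ω / n) atTop (𝓝 (∑ j, K j)) := by
  have : ∀ᵐ ω ∂(Measure.pi Q), ∀ j,
      Tendsto (fun n : ℕ => logLR (R j) (Q j) n (ω j) / n) atTop (𝓝 (K j)) :=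
    ae_all_iff.2 fun j => (measurePreserving_eval Q j).quasiMeasurePreserving.ae (hK j)
  filter_upwards [this] with ω hω
  unfold jointLR
  simp_rw [Finset.sum_div]
  exact tendsto_finsetSum _ fun j _ => hω j

variable [∀ j, IsProbabilityMeasure (R j)]

/-- On the first n observations, the density of ⨂ Q j against ⨂ R j is exp of the joint
log-likelihood ratio, hence at most exp x on the event considered. -/
lemma pi_inter_jointLR_lt_le (h : ∀ j, LocallyEquivalent (R j) (Q j)) {n : ℕ}
    {H : Set (∀ j, ℕ → E j)} (hH : MeasurableSet[obsFiltration E n] H) (x : ℝ) :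
    Measure.pi Q (H ∩ {ω | jointLR R Q n ω < x}) ≤
      ENNReal.ofReal (Real.exp x) * Measure.pi R H := by
  obtain ⟨H', hH', rfl⟩ := hH
  change Measure.pi Q (jointObs n ⁻¹' H' ∩ _) ≤ _ * Measure.pi R (jointObs n ⁻¹' H')
  set q : ∀ j, Measure (Fin n → E j) := fun j => (Q j).map (firstObs n) with hq
  set r : ∀ j, Measure (Fin n → E j) := fun j => (R j).map (firstObs n) with hr
  set S : Set (∀ j, Fin n → E j) := {y | ∑ j, llr (q j) (r j) (y j) < x}
  have hS : MeasurableSet S := measurableSet_lt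
    (Finset.measurable_sum _ fun j _ => (measurable_llr _ _).comp (measurable_pi_apply j))
    measurable_const
  have e : jointObs n ⁻¹' H' ∩ {ω | jointLR R Q n ω < x} = jointObs n ⁻¹' (H' ∩ S) := rfl
  rw [e, ← Measure.map_apply (measurable_jointObs n) (hH'.inter hS),
    ← Measure.map_apply (measurable_jointObs n) hH', map_jointObs_pi, map_jointObs_pi,
    pi_eq_withDensity q r fun j => (h j n).1, withDensity_apply _ (hH'.inter hS)]
  have hae : ∀ᵐ y ∂(Measure.pi r), ∀ j, (q j).rnDeriv (r j) (y j) =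
      ENNReal.ofReal (Real.exp (llr (q j) (r j) (y j))) := by
    refine ae_all_iff.2 fun j => ?_
    have : ∀ᵐ z ∂(r j), (q j).rnDeriv (r j) z =
        ENNReal.ofReal (Real.exp (llr (q j) (r j) z)) := by
      filter_upwards [exp_llr_of_ac' (q j) (r j) (h j n).2,
        Measure.rnDeriv_lt_top (q j) (r j)] with z hz hz'
      rw [hz, ENNReal.ofReal_toReal hz'.ne]
    exact (measurePreserving_eval r j).quasiMeasurePreserving.ae this
  calc ∫⁻ y in H' ∩ S, ∏ j, (q j).rnDeriv (r j) (y j) ∂(Measure.pi r)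
      ≤ ∫⁻ _ in H' ∩ S, ENNReal.ofReal (Real.exp x) ∂(Measure.pi r) := by
        refine setLIntegral_mono_ae measurable_const.aemeasurable ?_
        filter_upwards [hae] with y hy hyS
        simp_rw [hy]
        rw [← ENNReal.ofReal_prod_of_nonneg fun _ _ => (Real.exp_pos _).le, ← Real.exp_sum]
        exact ENNReal.ofReal_le_ofReal (Real.exp_le_exp.2 hyS.2.le)
    _ = ENNReal.ofReal (Real.exp x) * Measure.pi r (H' ∩ S) := by simp
    _ ≤ ENNReal.ofReal (Real.exp x) * Measure.pi r H' := by
        gcongr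
        exact Set.inter_subset_left

lemma tendsto_abs_log_zero : Tendsto (fun x : ℝ => |Real.log x|) (𝓝[>] 0) atTop :=
  tendsto_abs_atBot_atTop.comp Real.tendsto_log_nhdsGT_zero

/-- If a decision event `H` of a sequential procedure has probability at most `α` under `⨂ R j`,
then it is unlikely under `⨂ Q j` that it occurs before time `(1 - ε) |log α| / I`, where `I` is
the rate of growth of the log-likelihood ratio of `⨂ Q j` against `⨂ R j`. -/
lemma exists_bound_early_decision (h : ∀ j, LocallyEquivalent (R j) (Q j)) {K : Fin J → ℝ}
    (hK : ∀ j, ∀ᵐ x ∂(Q j), Tendsto (fun n : ℕ => logLR (R j) (Q j) n x / n) atTop (𝓝 (K j)))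
    (hpos : 0 < ∑ j, K j) {ε : ℝ} (hε0 : 0 < ε) (hε1 : ε < 1) :
    ∃ g : ℝ → ℝ≥0∞, Tendsto g (𝓝[>] 0) (𝓝 0) ∧
      ∀ (T : (∀ j, ℕ → E j) → ℕ∞) (hT : IsStoppingTime (ι := ℕ) (obsFiltration E) T)
        (H : Set (∀ j, ℕ → E j)) (_ : MeasurableSet[hT.measurableSpace] H)
        (α : ℝ) (_ : 0 < α) (_ : α < 1) (_ : Measure.pi R H ≤ ENNReal.ofReal α)
        (m : ℕ) (_ : (m : ℝ) ≤ (1 - ε) * |Real.log α| / ∑ j, K j),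
        Measure.pi Q (H ∩ {ω | T ω ≤ m}) ≤ g α := by
  set I := ∑ j, K j
  -- This c exceeds the drift I, and at time (1 - ε)|log α| / I the level c t equals (1 - ε / 2)|log
  -- α|. The change of measure then costs α ^ (-(1 - ε / 2)), which leaves α ^ (ε / 2).
  set c := (1 - ε / 2) / (1 - ε) * I with hc
  have h1ε : 0 < 1 - ε := by linarith
  have hIc : I < c := by
    rw [hc]
    refine lt_mul_of_one_lt_left hpos ?_
    rw [one_lt_div h1ε]
    linarith
  have hlim := tendsto_measure_exists_ge (measurable_jointLR R Q) (ae_tendsto_jointLR R Q hK)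
    (hpos.trans hIc) hIc
  refine ⟨fun α => Measure.pi Q {ω | ∃ n : ℕ, (n : ℝ) ≤ (1 - ε) * |Real.log α| / I ∧
    c * ((1 - ε) * |Real.log α| / I) ≤ jointLR R Q n ω} + ENNReal.ofReal (α ^ (ε / 2)), ?_, ?_⟩
  · rw [← add_zero (0 : ℝ≥0∞)]
    refine Tendsto.add (hlim.comp ?_) ?_
    · exact (tendsto_abs_log_zero.const_mul_atTop h1ε).atTop_div_const hpos
    · rw [← ENNReal.ofReal_zero]
      refine ENNReal.tendsto_ofReal (tendsto_nhdsWithin_of_tendsto_nhds ?_)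
      have := (Real.continuousAt_rpow_const 0 (ε / 2) (Or.inr (by positivity))).tendsto
      rwa [Real.zero_rpow (by positivity)] at this
  · intro T hT H hH α hα0 hα1 hHα m hm
    set x := (1 - ε / 2) * |Real.log α|
    have hcx : c * ((1 - ε) * |Real.log α| / I) = x := by
      simp only [hc, x]
      field_simp
    beta_reduce
    rw [hcx]
    have hHn : ∀ n : ℕ, MeasurableSet[obsFiltration E n] (H ∩ {ω | T ω = n}) := by
      intro n
      refine (hT.measurableSet_inter_eq_iff H n).1 ?_
      exact hH.inter (hT.measurableSet_eq' n)
    -- Either the log-likelihood ratio is atypically large before the horizon, or it is below x at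
    -- the stopping time. The second alternative is split by the value of T, so that each piece is
    -- measurable at a fixed time.
    have hsub : H ∩ {ω | T ω ≤ m} ⊆
        {ω | ∃ n : ℕ, (n : ℝ) ≤ (1 - ε) * |Real.log α| / I ∧ x ≤ jointLR R Q n ω} ∪
        ⋃ n ∈ Finset.range (m + 1), (H ∩ {ω | T ω = n}) ∩ {ω | jointLR R Q n ω < x} := by
      rintro ω ⟨hωH, hωT⟩
      obtain ⟨n, hn⟩ := ENat.ne_top_iff_exists.1 (ne_top_of_le_ne_top (ENat.natCast_ne_top m) hωT)
      have hωT' : T ω ≤ m := hωT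
      rw [← hn] at hωT'
      have hnm : n ≤ m := by exact_mod_cast hωT'
      by_cases hx : x ≤ jointLR R Q n ω
      · exact Or.inl ⟨n, le_trans (by exact_mod_cast hnm) hm, hx⟩
      · refine Or.inr (Set.mem_biUnion (Finset.mem_coe.2 (Finset.mem_range.2 (by omega)))
          ⟨⟨hωH, hn.symm⟩, not_le.1 hx⟩)
    refine (measure_mono hsub).trans ((measure_union_le _ _).trans ?_)
    gcongr
    calc _ ≤ ∑ n ∈ Finset.range (m + 1), Measure.pi Q
          ((H ∩ {ω | T ω = n}) ∩ {ω | jointLR R Q n ω < x}) := measure_biUnion_finset_le _ _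
      _ ≤ ∑ n ∈ Finset.range (m + 1),
          ENNReal.ofReal (Real.exp x) * Measure.pi R (H ∩ {ω | T ω = n}) :=
          Finset.sum_le_sum fun n _ => pi_inter_jointLR_lt_le R Q h (hHn n) x
      _ = ENNReal.ofReal (Real.exp x) *
          Measure.pi R (⋃ n ∈ Finset.range (m + 1), H ∩ {ω | T ω = n}) := by
          rw [← Finset.mul_sum, measure_biUnion_finset]
          · intro i _ k _ hik
            refine Set.disjoint_left.2 fun ω hi hk => hik ?_
            have h1 : T ω = i := hi.2
            have h2 : T ω = k := hk.2
            rw [h1] at h2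
            exact_mod_cast h2
          · exact fun n _ => (obsFiltration E).le n _ (hHn n)
      _ ≤ ENNReal.ofReal (Real.exp x) * ENNReal.ofReal α := by
          gcongr
          refine le_trans (measure_mono ?_) hHα
          exact Set.iUnion₂_subset fun n _ => Set.inter_subset_left
      _ = ENNReal.ofReal (α ^ (ε / 2)) := by
          rw [← ENNReal.ofReal_mul (Real.exp_pos _).le, Real.rpow_def_of_pos hα0]
          congr 1
          calc Real.exp x * α = Real.exp x * Real.exp (Real.log α) := by rw [Real.exp_log hα0]
            _ = Real.exp (Real.log α * (ε / 2)) := by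
              rw [← Real.exp_add]
              simp only [x]
              rw [abs_of_neg (Real.log_neg hα0 hα1)]
              congr 1
              ring

end ChangeOfMeasure

/-! ### Order statistics -/

section OrderStat

variable {J : ℕ} {S : Finset (Fin J)} {v w : Fin J → ℝ≥0∞} {i : ℕ}

lemma mul_orderStat_le {c : ℝ≥0∞} (hc0 : c ≠ 0) (hc : c ≠ ∞) (h : ∀ j ∈ S, c * w j ≤ v j) :
    c * orderStat S w i ≤ orderStat S v i := by
  refine le_sInf fun t ht => ?_
  have : orderStat S w i ≤ t / c := by
    refine sInf_le (le_trans (Set.mem_ofPred.1 ht) (Finset.card_le_card fun j hj => ?_))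
    rw [Finset.mem_filter] at hj ⊢
    refine ⟨hj.1, ?_⟩
    rw [ENNReal.le_div_iff_mul_le (Or.inl hc0) (Or.inl hc), mul_comm]
    exact (h j hj.1).trans hj.2
  calc c * orderStat S w i ≤ c * (t / c) := by gcongr
    _ = t := ENNReal.mul_div_cancel hc0 hc

/-- The infimum is attained: the counting function jumps only at values v j, so a count below i at m
would stay below i up to the next value above m. -/
lemma le_card_filter_le_orderStat (h : orderStat S v i ≠ ∞) :
    i ≤ (S.filter fun j => v j ≤ orderStat S v i).card := by
  by_contra! hlt
  set m := orderStat S v i with hm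
  rcases (S.filter fun j => m < v j).eq_empty_or_nonempty with he | hne
  · refine h ?_
    rw [hm]
    unfold orderStat
    have hall : ∀ t : ℝ≥0∞, ¬ i ≤ (S.filter fun j => v j ≤ t).card := by
      intro t ht
      refine absurd (ht.trans (Finset.card_le_card fun j hj => ?_)) (not_le.2 hlt)
      rw [Finset.mem_filter] at hj ⊢
      refine ⟨hj.1, not_lt.1 fun hlt' => ?_⟩
      have : j ∈ S.filter fun j => m < v j := Finset.mem_filter.2 ⟨hj.1, hlt'⟩
      simp [he] at this
    simp [hall]
  · obtain ⟨k, hk, hkmin⟩ := Finset.exists_min_image _ v hne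
    have hk' := (Finset.mem_filter.1 hk).2
    have : v k ≤ m := by
      refine le_sInf fun t ht => ?_
      by_contra! htk
      refine absurd ((Set.mem_ofPred.1 ht).trans (Finset.card_le_card fun j hj => ?_))
        (not_le.2 hlt)
      rw [Finset.mem_filter] at hj ⊢
      refine ⟨hj.1, not_lt.1 fun hlt' => ?_⟩
      exact absurd (hkmin j (Finset.mem_filter.2 ⟨hj.1, hlt'⟩)) (not_le.2 (hj.2.trans_lt htk))
    exact absurd hk' (not_lt.2 this)

lemma orderStat_ne_zero (hv : ∀ j, v j ≠ 0) (hi : 1 ≤ i) : orderStat S v i ≠ 0 := by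
  intro h0
  have h := le_card_filter_le_orderStat (S := S) (v := v) (i := i) (by simp [h0])
  rw [h0] at h
  obtain ⟨j, hj⟩ := Finset.card_pos.1 (lt_of_lt_of_le hi h)
  simp [hv j] at hj

lemma orderStat_ne_top (hv : ∀ j, v j ≠ ∞) (hi : i ≤ S.card) : orderStat S v i ≠ ∞ := by
  refine ne_top_of_le_ne_top (ENNReal.sum_ne_top.2 fun j (_ : j ∈ S) => hv j) (sInf_le ?_)
  change i ≤ _
  rwa [Finset.filter_true_of_mem fun j hj => Finset.single_le_sum (fun _ _ => zero_le) hj]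

/-- Up to `r` elements being unavailable, the `m` cheapest available elements of `S` cost at most
the sum of the order statistics `r + 1, …, r + m`. -/
lemma exists_subset_sum_le {G : Finset (Fin J)} {r : ℕ} (hr : (S \ G).card ≤ r)
    (m : ℕ) (h : ∑ i ∈ Finset.Icc (r + 1) (r + m), orderStat S v i ≠ ∞) :
    ∃ U ⊆ G, U ⊆ S ∧ U.card = m ∧
      ∑ j ∈ U, v j ≤ ∑ i ∈ Finset.Icc (r + 1) (r + m), orderStat S v i := by
  induction m with
  | zero => exact ⟨∅, by simp⟩
  | succ m ih =>
    rw [← add_assoc, Finset.sum_Icc_succ_top (by omega)] at h ⊢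
    rw [ENNReal.add_ne_top] at h
    obtain ⟨U, hUG, hUS, hUc, hU⟩ := ih h.1
    have hcard := le_card_filter_le_orderStat h.2
    -- At least r + m + 1 elements have value at most the next order statistic, while at most r are
    -- unavailable and m are already used.
    obtain ⟨j, hj, hj'⟩ : ∃ j ∈ S.filter (fun j => v j ≤ orderStat S v (r + m + 1)),
        j ∉ (S \ G) ∪ U := by
      refine Finset.exists_mem_notMem_of_card_lt_card ?_
      have := Finset.card_union_le (S \ G) U
      omega
    rw [Finset.mem_filter] at hj
    simp only [Finset.mem_union, Finset.mem_sdiff, not_or, not_and, not_not] at hj'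
    refine ⟨insert j U, Finset.insert_subset (hj'.1 hj.1) hUG, Finset.insert_subset hj.1 hUS,
      ?_, ?_⟩
    · rw [Finset.card_insert_of_notMem hj'.2, hUc]
    · rw [Finset.sum_insert hj'.2, add_comm]
      exact add_le_add hU hj.2

end OrderStat

/-! ### The limiting performance -/

section InfoSum

variable {J : ℕ} {I I₀ I₁ : Fin J → ℝ} {B : Finset (Fin J)} {ℓ u : ℕ}

lemma infoSum_ne_zero (hI : ∀ j, 0 < I j) (h1 : 1 ≤ ℓ) (hu : ℓ ≤ u) : infoSum I B ℓ u ≠ 0 := by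
  unfold infoSum
  rw [Ne, Finset.sum_eq_zero_iff]
  intro h
  exact orderStat_ne_zero (fun j => (ENNReal.ofReal_pos.2 (hI j)).ne') h1
    (h ℓ (Finset.mem_Icc.2 ⟨le_rfl, hu⟩))

lemma infoSum_ne_top (hu : u ≤ B.card) : infoSum I B ℓ u ≠ ∞ :=
  ENNReal.sum_ne_top.2 fun _ hi => orderStat_ne_top (fun _ => ENNReal.ofReal_ne_top)
    ((Finset.mem_Icc.1 hi).2.trans hu)

lemma infoSum_mono {ℓ' u' : ℕ} (hℓ : ℓ' ≤ ℓ) (hu : u ≤ u') :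
    infoSum I B ℓ u ≤ infoSum I B ℓ' u' :=
  Finset.sum_le_sum_of_subset (Finset.Icc_subset_Icc hℓ hu)

/-- The larger of `|log α| / D₁` and `|log β| / D₀`. -/
noncomputable def maxRatio (D₁ D₀ : ℝ≥0∞) (α β : ℝ) : ℝ≥0∞ :=
  max (ENNReal.ofReal |Real.log α| / D₁) (ENNReal.ofReal |Real.log β| / D₀)

lemma maxRatio_anti {D₁ D₀ D₁' D₀' : ℝ≥0∞} {α β : ℝ} (h₁ : D₁ ≤ D₁') (h₀ : D₀ ≤ D₀') :
    maxRatio D₁' D₀' α β ≤ maxRatio D₁ D₀ α β :=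
  max_le_max (ENNReal.div_le_div_left h₁ _) (ENNReal.div_le_div_left h₀ _)

lemma maxRatio_ne_top {D₁ D₀ : ℝ≥0∞} (h₁ : D₁ ≠ 0) (h₀ : D₀ ≠ 0) (α β : ℝ) :
    maxRatio D₁ D₀ α β ≠ ∞ := by
  unfold maxRatio
  rw [Ne, max_eq_top, not_or]
  exact ⟨ENNReal.div_ne_top ENNReal.ofReal_ne_top h₁, ENNReal.div_ne_top ENNReal.ofReal_ne_top h₀⟩

lemma tendsto_fst_toZero : Tendsto Prod.fst toZero (𝓝[>] (0 : ℝ)) := tendsto_fst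

lemma tendsto_snd_toZero : Tendsto Prod.snd toZero (𝓝[>] (0 : ℝ)) := tendsto_snd

lemma tendsto_ofReal_abs_log_div {D : ℝ≥0∞} (hD : D ≠ ∞) :
    Tendsto (fun x : ℝ => ENNReal.ofReal |Real.log x| / D) (𝓝[>] 0) (𝓝 ∞) := by
  have := ENNReal.Tendsto.div_const (b := D)
    (ENNReal.tendsto_ofReal_atTop.comp tendsto_abs_log_zero) (Or.inl ENNReal.top_ne_zero)
  rwa [ENNReal.top_div_of_ne_top hD] at this

lemma tendsto_maxRatio {D₁ D₀ : ℝ≥0∞} (h : D₁ ≠ ∞ ∨ D₀ ≠ ∞) :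
    Tendsto (fun p : ℝ × ℝ => maxRatio D₁ D₀ p.1 p.2) toZero (𝓝 ∞) := by
  rcases h with h | h
  · exact tendsto_of_tendsto_of_tendsto_of_le_of_le
      ((tendsto_ofReal_abs_log_div h).comp tendsto_fst_toZero) tendsto_const_nhds
      (fun p => le_max_left _ _) fun _ => le_top
  · exact tendsto_of_tendsto_of_tendsto_of_le_of_le
      ((tendsto_ofReal_abs_log_div h).comp tendsto_snd_toZero) tendsto_const_nhds
      (fun p => le_max_right _ _) fun _ => le_top

variable {k₁ k₂ : ℕ} {A : Finset (Fin J)} {α β : ℝ}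

/-- Here s and r count false positives and false negatives. Lowering the starting indices of both
windows by min r s keeps their upper ends and can only enlarge the sums, which gives a term of L_A
with index |s - r|. -/
lemma limitSize_le_maxRatio {r s : ℕ} (hs : s < k₁) (hr : r < k₂) :
    limitSize I₀ I₁ k₁ k₂ A α β ≤ maxRatio (infoSum I₁ A (r + 1) (r + (k₁ - s)))
      (infoSum I₀ Aᶜ (s + 1) (s + (k₂ - r))) α β := by
  rcases le_total r s with h | h
  · refine (min_le_left _ _).trans ((iInf₂_le (s - r) (by simp; omega)).trans ?_)
    exact maxRatio_anti (infoSum_mono (by omega) (by omega)) (infoSum_mono (by omega) (by omega))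
  · refine (min_le_right _ _).trans ((iInf₂_le (r - s) (by simp; omega)).trans ?_)
    exact maxRatio_anti (infoSum_mono (by omega) (by omega)) (infoSum_mono (by omega) (by omega))

lemma limitSize_ne_top (hI₀ : ∀ j, 0 < I₀ j) (hI₁ : ∀ j, 0 < I₁ j) (hk₁ : 1 ≤ k₁)
    (hk₂ : 1 ≤ k₂) : limitSize I₀ I₁ k₁ k₂ A α β ≠ ∞ :=
  ne_top_of_le_ne_top (maxRatio_ne_top (infoSum_ne_zero hI₁ (by omega) (by omega))
    (infoSum_ne_zero hI₀ (by omega) (by omega)) α β) (limitSize_le_maxRatio (r := 0) (s := 0)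
    hk₁ hk₂)

/-- To bound a quantity by a multiple of `L_A`, it suffices to bound it by the same multiple of
each of the terms, and `Ľ_A(0) = L̂_A(0)` need not be considered. -/
lemma le_mul_limitSize (hk₁ : 1 ≤ k₁) {c x : ℝ≥0∞}
    (hhat : ∀ ℓ ∈ Finset.Ico 0 k₁, x ≤ c * LHat I₀ I₁ k₁ k₂ A α β ℓ)
    (hcheck : ∀ ℓ ∈ Finset.Ico 1 k₂, x ≤ c * LCheck I₀ I₁ k₁ k₂ A α β ℓ)
    (hc : c ≠ 0) (hc' : c ≠ ∞) : x ≤ c * limitSize I₀ I₁ k₁ k₂ A α β := by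
  rw [mul_comm, ← ENNReal.div_le_iff_le_mul (Or.inl hc) (Or.inl hc')]
  have hdiv : ∀ {y}, x ≤ c * y → x / c ≤ y := fun h => by
    rwa [ENNReal.div_le_iff_le_mul (Or.inl hc) (Or.inl hc'), mul_comm]
  refine le_min (le_iInf₂ fun ℓ hℓ => hdiv (hhat ℓ hℓ)) (le_iInf₂ fun ℓ hℓ => ?_)
  rcases Nat.eq_zero_or_pos ℓ with rfl | h
  · have : LCheck I₀ I₁ k₁ k₂ A α β 0 = LHat I₀ I₁ k₁ k₂ A α β 0 := by simp [LCheck, LHat]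
    rw [this]
    exact hdiv (hhat 0 (by simp; omega))
  · exact hdiv (hcheck ℓ (by simp at hℓ ⊢; omega))

/-- Since u₁ + u₀ ≤ J = |A| + |Aᶜ|, one of the two windows fits in its set. This is why every term
of L_A tends to infinity. -/
lemma infoSum_ne_top_or (hk : k₁ + k₂ ≤ J) {u₁ ℓ₁ u₀ ℓ₀ : ℕ} (hu : u₁ + u₀ ≤ k₁ + k₂) :
    infoSum I₁ A ℓ₁ u₁ ≠ ∞ ∨ infoSum I₀ Aᶜ ℓ₀ u₀ ≠ ∞ := by
  have hcard := Finset.card_add_card_compl A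
  rw [Fintype.card_fin] at hcard
  rcases le_or_gt u₁ A.card with h | h
  · exact Or.inl (infoSum_ne_top h)
  · exact Or.inr (infoSum_ne_top (by omega))

lemma eventually_limitSize_ne_zero (hk₁ : 1 ≤ k₁) (hk : k₁ + k₂ ≤ J) :
    ∀ᶠ p in toZero, limitSize I₀ I₁ k₁ k₂ A p.1 p.2 ≠ 0 := by
  have h1 : ∀ᶠ p in toZero, ∀ ℓ ∈ Finset.Ico 0 k₁, 1 ≤ LHat I₀ I₁ k₁ k₂ A p.1 p.2 ℓ := by
    refine (Finset.eventually_all _).2 fun ℓ hℓ => ?_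
    rw [Finset.mem_Ico] at hℓ
    exact (tendsto_maxRatio (infoSum_ne_top_or hk (by omega))).eventually_const_le
      ENNReal.one_lt_top
  have h2 : ∀ᶠ p in toZero, ∀ ℓ ∈ Finset.Ico 1 k₂, 1 ≤ LCheck I₀ I₁ k₁ k₂ A p.1 p.2 ℓ := by
    refine (Finset.eventually_all _).2 fun ℓ hℓ => ?_
    rw [Finset.mem_Ico] at hℓ
    exact (tendsto_maxRatio (infoSum_ne_top_or hk (by omega))).eventually_const_le
      ENNReal.one_lt_top
  filter_upwards [h1, h2] with p hp1 hp2
  have := le_mul_limitSize (x := 1) (c := 1) hk₁ (by simpa using hp1) (by simpa using hp2)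
    one_ne_zero ENNReal.one_ne_top
  intro h0
  simp [h0] at this

end InfoSum

/-! ### Times without deviating streams -/

section Bounds

variable {J : ℕ} {E : Fin J → Type*} [∀ j, MeasurableSpace (E j)]

lemma infoSum_le_posSum {A : Finset (Fin J)} {x I : Fin J → ℝ} {c : ℝ} (hc : 0 < c)
    (hA : posStreams x = A) (h : ∀ j ∈ A, c * I j ≤ x j) (ℓ u : ℕ) :
    ENNReal.ofReal c * infoSum I A ℓ u ≤ posSum x ℓ u := by
  unfold infoSum posSum
  rw [hA, Finset.mul_sum]
  refine Finset.sum_le_sum fun i _ => mul_orderStat_le (ENNReal.ofReal_pos.2 hc).ne'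
    ENNReal.ofReal_ne_top fun j hj => ?_
  rw [← ENNReal.ofReal_mul hc.le]
  exact ENNReal.ofReal_le_ofReal (h j hj)

lemma infoSum_le_negSum {B : Finset (Fin J)} {x I : Fin J → ℝ} {c : ℝ} (hc : 0 < c)
    (hB : negStreams x = B) (h : ∀ j ∈ B, c * I j ≤ -x j) (ℓ u : ℕ) :
    ENNReal.ofReal c * infoSum I B ℓ u ≤ negSum x ℓ u := by
  unfold infoSum negSum
  rw [hB, Finset.mul_sum]
  refine Finset.sum_le_sum fun i _ => mul_orderStat_le (ENNReal.ofReal_pos.2 hc).ne'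
    ENNReal.ofReal_ne_top fun j hj => ?_
  rw [← ENNReal.ofReal_mul hc.le]
  exact ENNReal.ofReal_le_ofReal (h j hj)

/-- A time that is at most the first good `n + 1` with `n ≥ N` is bounded by `N + 1` plus the
number of bad times. -/
lemma toENNReal_le_add_tsum {T : ℕ∞} {N : ℕ} {bad : ℕ → Prop} [DecidablePred bad]
    (h : ∀ n, N ≤ n → ¬ bad n → T ≤ (n + 1 : ℕ)) :
    (T : ℝ≥0∞) ≤ (N + 1 : ℕ) + ∑' n, if bad n then 1 else 0 := by
  have hsum : ∀ m, (∀ n, N ≤ n → n < N + m → bad n) →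
      (m : ℝ≥0∞) ≤ ∑' n, if bad n then 1 else 0 := by
    intro m hm
    refine le_trans (le_of_eq ?_) (ENNReal.sum_le_tsum (Finset.Ico N (N + m)))
    rw [Finset.sum_congr rfl fun n hn => if_pos (hm n (Finset.mem_Ico.1 hn).1
      (Finset.mem_Ico.1 hn).2)]
    simp
  -- If every time from N on is bad, the number of bad times is infinite and nothing is required of
  -- T.
  by_cases hex : ∃ m, ¬ bad (N + m)
  · classical
    have hm := Nat.find_spec hex
    set m := Nat.find hex with hmdef
    have h1 : (T : ℝ≥0∞) ≤ ((N + m + 1 : ℕ) : ℝ≥0∞) := by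
      have := h (N + m) (by omega) hm
      exact_mod_cast ENat.toENNReal_le.2 this
    refine h1.trans ?_
    have h2 : ((N + m + 1 : ℕ) : ℝ≥0∞) = (N + 1 : ℕ) + (m : ℝ≥0∞) := by
      push_cast
      ring
    rw [h2]
    gcongr
    refine hsum m fun n hn hn' => ?_
    have := Nat.find_min hex (m := n - N) (by omega)
    rwa [not_not, Nat.add_sub_cancel' hn] at this
  · push Not at hex
    have htop : (∑' n, if bad n then (1 : ℝ≥0∞) else 0) = ∞ := by
      refine ENNReal.eq_top_of_forall_nnreal_le fun r => ?_
      obtain ⟨m, hm⟩ := exists_nat_ge r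
      refine le_trans (by exact_mod_cast hm) (hsum m fun n hn _ => ?_)
      have := hex (n - N)
      rwa [Nat.add_sub_cancel' hn] at this
    rw [htop]
    simp

variable {P₀ P₁ : ∀ j : Fin J, Measure (ℕ → E j)} {I₀ I₁ : Fin J → ℝ} {k₁ k₂ : ℕ}

/-! ### Upper bound for the expected sample size -/

/-- The log-likelihood ratio of stream `j` at time `n` is at distance less than `c n I` from zero,
or has the wrong sign for the set `A` of signals. -/
def wrongStream (P₀ P₁ : ∀ j : Fin J, Measure (ℕ → E j)) (I₀ I₁ : Fin J → ℝ) (A : Finset (Fin J))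
    (c : ℝ) (n : ℕ) (j : Fin J) : Set (ℕ → E j) :=
  if j ∈ A then {x | logLR (P₀ j) (P₁ j) n x < c * I₁ j * n}
  else {x | -logLR (P₀ j) (P₁ j) n x < c * I₀ j * n}

lemma measurableSet_wrongStream (A : Finset (Fin J)) (c : ℝ) (n : ℕ) (j : Fin J) :
    MeasurableSet (wrongStream P₀ P₁ I₀ I₁ A c n j) := by
  unfold wrongStream
  split_ifs
  · exact measurableSet_lt (measurable_logLR _ _ _) measurable_const
  · exact measurableSet_lt (measurable_logLR _ _ _).neg measurable_const

/-- When no stream is wrong, the signs of the log-likelihood ratios identify A exactly, so the order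
statistics run over A and Aᶜ and can be compared termwise. -/
lemma le_sums_of_notMem_wrongStream (hI₀ : ∀ j, 0 < I₀ j) (hI₁ : ∀ j, 0 < I₁ j)
    {A : Finset (Fin J)} {c : ℝ} (hc : 0 < c) {n : ℕ} (hn : 0 < n) {ω : ∀ j, ℕ → E j}
    (h : ∀ j, ω j ∉ wrongStream P₀ P₁ I₀ I₁ A c n j) (ℓ u : ℕ) :
    ENNReal.ofReal (c * n) * infoSum I₁ A ℓ u ≤ posSum (llrVec P₀ P₁ n ω) ℓ u ∧
      ENNReal.ofReal (c * n) * infoSum I₀ Aᶜ ℓ u ≤ negSum (llrVec P₀ P₁ n ω) ℓ u := by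
  have hn' : (0 : ℝ) < n := by exact_mod_cast hn
  have hpos : ∀ j ∈ A, c * n * I₁ j ≤ llrVec P₀ P₁ n ω j := by
    intro j hj
    have h1 := h j
    simp only [wrongStream, hj, if_true, Set.mem_ofPred_eq, not_lt] at h1
    unfold llrVec
    linarith
  have hneg : ∀ j ∉ A, c * n * I₀ j ≤ -llrVec P₀ P₁ n ω j := by
    intro j hj
    have h1 := h j
    simp only [wrongStream, hj, if_false, Set.mem_ofPred_eq, not_lt] at h1
    unfold llrVec
    linarith
  have h1 : ∀ j, j ∈ A ↔ 0 < llrVec P₀ P₁ n ω j := by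
    intro j
    by_cases hj : j ∈ A
    · have := hpos j hj
      have := mul_pos (mul_pos hc hn') (hI₁ j)
      simp only [hj, true_iff]
      linarith
    · have := hneg j hj
      have := mul_pos (mul_pos hc hn') (hI₀ j)
      simp only [hj, false_iff]
      linarith
  refine ⟨infoSum_le_posSum (mul_pos hc hn') ?_ hpos ℓ u,
    infoSum_le_negSum (mul_pos hc hn') ?_ (fun j hj => hneg j (Finset.mem_compl.1 hj)) ℓ u⟩
  · ext j
    simp [posStreams, h1]
  · ext j
    simp [negStreams, h1]

variable [∀ j, IsProbabilityMeasure (P₀ j)] [∀ j, IsProbabilityMeasure (P₁ j)]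

instance isProbabilityMeasure_ite (A : Finset (Fin J)) (j : Fin J) :
    IsProbabilityMeasure (if j ∈ A then P₁ j else P₀ j) := by
  split_ifs <;> infer_instance

instance isProbabilityMeasure_signalLaw (A : Finset (Fin J)) :
    IsProbabilityMeasure (signalLaw P₀ P₁ A) := by
  unfold signalLaw
  infer_instance

lemma tsum_wrongStream_lt_top (hequiv : ∀ j, LocallyEquivalent (P₀ j) (P₁ j))
    (hI₀ : ∀ j, 0 < I₀ j) (hI₁ : ∀ j, 0 < I₁ j)
    (hstream : ∀ j, StreamAssumption (P₀ j) (P₁ j) (I₀ j) (I₁ j)) (A : Finset (Fin J)) {c : ℝ}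
    (hc : c < 1) :
    ∑' n : ℕ, signalLaw P₀ P₁ A {ω | ∃ j, ω j ∈ wrongStream P₀ P₁ I₀ I₁ A c (n + 1) j} < ∞ := by
  have hj : ∀ j, ∑' n : ℕ, (if j ∈ A then P₁ j else P₀ j)
      (wrongStream P₀ P₁ I₀ I₁ A c (n + 1) j) < ∞ := by
    intro j
    by_cases hjA : j ∈ A
    · simp only [hjA, wrongStream, if_true]
      exact (hstream j).tsum_measure_lt (hequiv j) (by nlinarith [hI₁ j])
    · simp only [hjA, wrongStream, if_false]
      convert ((hstream j).swap (hequiv j)).tsum_measure_lt (hequiv j).symm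
        (c := c * I₀ j) (by nlinarith [hI₀ j]) using 3 with n
      refine measure_congr ?_
      filter_upwards [logLR_swap' (hequiv j) (n + 1)] with x hx
      refine propext ?_
      change -logLR (P₀ j) (P₁ j) (n + 1) x < _ ↔ logLR (P₁ j) (P₀ j) (n + 1) x < _
      rw [hx]
  calc ∑' n : ℕ, signalLaw P₀ P₁ A {ω | ∃ j, ω j ∈ wrongStream P₀ P₁ I₀ I₁ A c (n + 1) j}
      ≤ ∑' n : ℕ, ∑ j, (if j ∈ A then P₁ j else P₀ j)
          (wrongStream P₀ P₁ I₀ I₁ A c (n + 1) j) := by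
        refine ENNReal.tsum_le_tsum fun n => ?_
        rw [Set.ofPred_exists]
        refine (measure_iUnion_fintype_le _ _).trans (Finset.sum_le_sum fun j _ => le_of_eq ?_)
        exact (measurePreserving_eval (fun j => if j ∈ A then P₁ j else P₀ j) j).measure_preimage
          (measurableSet_wrongStream A c (n + 1) j).nullMeasurableSet
    _ = ∑ j, ∑' n : ℕ, (if j ∈ A then P₁ j else P₀ j)
          (wrongStream P₀ P₁ I₀ I₁ A c (n + 1) j) :=
        Summable.tsum_finsetSum fun _ _ => ENNReal.summable
    _ < ∞ := ENNReal.sum_lt_top.2 fun j _ => hj j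

/-- A time at which a rule stops as soon as the sums of the least significant log-likelihood ratios
of both signs are above the thresholds has expectation asymptotically at most `maxRatio`. -/
lemma eventually_expectedSize_le_maxRatio (hequiv : ∀ j, LocallyEquivalent (P₀ j) (P₁ j))
    (hI₀ : ∀ j, 0 < I₀ j) (hI₁ : ∀ j, 0 < I₁ j)
    (hstream : ∀ j, StreamAssumption (P₀ j) (P₁ j) (I₀ j) (I₁ j)) (A : Finset (Fin J))
    {a b : ℝ × ℝ → ℝ} (ha : Tendsto (fun p : ℝ × ℝ => a p / |Real.log p.2|) toZero (𝓝 1))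
    (hb : Tendsto (fun p : ℝ × ℝ => b p / |Real.log p.1|) toZero (𝓝 1))
    {ℓ₁ u₁ ℓ₀ u₀ : ℕ} (hℓ₁ : 1 ≤ ℓ₁) (hu₁ : ℓ₁ ≤ u₁) (hℓ₀ : 1 ≤ ℓ₀) (hu₀ : ℓ₀ ≤ u₀)
    (htop : infoSum I₁ A ℓ₁ u₁ ≠ ∞ ∨ infoSum I₀ Aᶜ ℓ₀ u₀ ≠ ∞) {η : ℝ} (hη : 0 < η) :
    ∀ᶠ p in toZero, ∀ T : (∀ j, ℕ → E j) → ℕ∞,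
      (∀ ω (n : ℕ), 1 ≤ n → ENNReal.ofReal (b p) ≤ posSum (llrVec P₀ P₁ n ω) ℓ₁ u₁ →
        ENNReal.ofReal (a p) ≤ negSum (llrVec P₀ P₁ n ω) ℓ₀ u₀ → T ω ≤ n) →
      expectedSize P₀ P₁ A T ≤ ENNReal.ofReal (1 + η) *
        maxRatio (infoSum I₁ A ℓ₁ u₁) (infoSum I₀ Aᶜ ℓ₀ u₀) p.1 p.2 := by
  obtain ⟨ε, hε0, hε1, hεη⟩ : ∃ ε : ℝ, 0 < ε ∧ ε < 1 ∧ (1 + ε) / (1 - ε) + ε ≤ 1 + η := by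
    have hcont : Tendsto (fun ε : ℝ => (1 + ε) / (1 - ε) + ε) (𝓝[>] 0) (𝓝 1) := by
      refine tendsto_nhdsWithin_of_tendsto_nhds ?_
      have : ContinuousAt (fun ε : ℝ => (1 + ε) / (1 - ε) + ε) 0 :=
        ((continuousAt_const.add continuousAt_id).div (continuousAt_const.sub continuousAt_id)
          (by simp)).add continuousAt_id
      simpa [ContinuousAt] using this
    obtain ⟨ε, h1, h2, h3⟩ := ((hcont.eventually_le_const (by linarith : (1 : ℝ) < 1 + η)).and
      ((eventually_mem_nhdsWithin).and
        (nhdsWithin_le_nhds (eventually_lt_nhds (zero_lt_one' ℝ))))).exists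
    exact ⟨ε, h2, h3, h1⟩
  have h1ε : 0 < 1 - ε := by linarith
  set D₁ := infoSum I₁ A ℓ₁ u₁
  set D₀ := infoSum I₀ Aᶜ ℓ₀ u₀
  have hD₁ : D₁ ≠ 0 := infoSum_ne_zero hI₁ hℓ₁ hu₁
  have hD₀ : D₀ ≠ 0 := infoSum_ne_zero hI₀ hℓ₀ hu₀
  have hK := tsum_wrongStream_lt_top hequiv hI₀ hI₁ hstream A (by linarith : 1 - ε < 1)
  set K := ∑' n : ℕ, signalLaw P₀ P₁ A
    {ω | ∃ j, ω j ∈ wrongStream P₀ P₁ I₀ I₁ A (1 - ε) (n + 1) j}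
  -- The additive error consists of K, the expected number of bad times, and 2, from rounding M up
  -- and from the shift n + 1. It is eventually at most ε times the main term.
  have hbig : ∀ᶠ p in toZero, (2 + K) / ENNReal.ofReal ε ≤ maxRatio D₁ D₀ p.1 p.2 := by
    refine (tendsto_maxRatio htop).eventually_const_le ?_
    exact ENNReal.div_lt_top (by finiteness) (ENNReal.ofReal_pos.2 hε0).ne'
  have hlog₁ : ∀ᶠ p in toZero, 0 < |Real.log p.1| :=
    (tendsto_abs_log_zero.comp tendsto_fst_toZero).eventually_gt_atTop 0
  have hlog₀ : ∀ᶠ p in toZero, 0 < |Real.log p.2| :=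
    (tendsto_abs_log_zero.comp tendsto_snd_toZero).eventually_gt_atTop 0
  filter_upwards [hbig, hlog₁, hlog₀, ha.eventually_le_const (by linarith : 1 < 1 + ε),
    hb.eventually_le_const (by linarith : 1 < 1 + ε)] with p hp hl₁ hl₀ hap hbp T hT
  rw [div_le_iff₀ hl₀] at hap
  rw [div_le_iff₀ hl₁] at hbp
  set X := maxRatio D₁ D₀ p.1 p.2 with hX
  have hXtop : X ≠ ∞ := maxRatio_ne_top hD₁ hD₀ _ _
  set M := (1 + ε) / (1 - ε) * X.toReal
  have hM0 : 0 ≤ M := by positivity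
  have hMX : ENNReal.ofReal M = ENNReal.ofReal ((1 + ε) / (1 - ε)) * X := by
    rw [ENNReal.ofReal_mul (by positivity), ENNReal.ofReal_toReal hXtop]
  set N := ⌈M⌉₊
  -- If D = ∞, the corresponding threshold condition holds automatically; this matches the
  -- convention c / ∞ = 0.
  have hthr : ∀ {y c D d : ℝ≥0∞} , D ≠ 0 → d ≠ 0 → c / D ≤ X →
      y ≤ ENNReal.ofReal (1 + ε) * c → ENNReal.ofReal (1 + ε) * X ≤ d → y ≤ d * D := by
    intro y c D d hD hd hcD hy hd'
    rcases eq_or_ne D ∞ with rfl | hDtop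
    · rw [ENNReal.mul_top hd]
      exact le_top
    · rw [ENNReal.div_le_iff_le_mul (Or.inl hD) (Or.inl hDtop)] at hcD
      calc y ≤ ENNReal.ofReal (1 + ε) * c := hy
        _ ≤ ENNReal.ofReal (1 + ε) * (X * D) := by gcongr
        _ = ENNReal.ofReal (1 + ε) * X * D := (mul_assoc _ _ _).symm
        _ ≤ d * D := by gcongr
  have hgood : ∀ ω (n : ℕ), N ≤ n →
      ¬ (∃ j, ω j ∈ wrongStream P₀ P₁ I₀ I₁ A (1 - ε) (n + 1) j) → T ω ≤ (n + 1 : ℕ) := by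
    intro ω n hn hω
    push Not at hω
    have hd0 : ENNReal.ofReal ((1 - ε) * (n + 1 : ℕ)) ≠ 0 :=
      (ENNReal.ofReal_pos.2 (by positivity)).ne'
    have hd : ENNReal.ofReal (1 + ε) * X ≤ ENNReal.ofReal ((1 - ε) * (n + 1 : ℕ)) := by
      rw [← ENNReal.ofReal_toReal hXtop, ← ENNReal.ofReal_mul (by linarith)]
      refine ENNReal.ofReal_le_ofReal ?_
      have h1 : M ≤ n := (Nat.le_ceil M).trans (by exact_mod_cast hn)
      have h2 : (1 + ε) * X.toReal = (1 - ε) * M := by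
        simp only [M]
        field_simp
      rw [h2]
      push_cast
      gcongr
      linarith
    have hs := le_sums_of_notMem_wrongStream hI₀ hI₁ h1ε n.succ_pos hω
    refine hT ω (n + 1) (by omega) (le_trans ?_ (hs ℓ₁ u₁).1) (le_trans ?_ (hs ℓ₀ u₀).2)
    · refine hthr hD₁ hd0 (le_max_left _ _) ?_ hd
      rw [← ENNReal.ofReal_mul (by linarith)]
      exact ENNReal.ofReal_le_ofReal hbp
    · refine hthr hD₀ hd0 (le_max_right _ _) ?_ hd
      rw [← ENNReal.ofReal_mul (by linarith)]
      exact ENNReal.ofReal_le_ofReal hap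
  have hmeas : ∀ n : ℕ, MeasurableSet
      {ω : ∀ j, ℕ → E j | ∃ j, ω j ∈ wrongStream P₀ P₁ I₀ I₁ A (1 - ε) (n + 1) j} := by
    intro n
    rw [Set.ofPred_exists]
    exact MeasurableSet.iUnion fun j => measurable_pi_apply j
      (measurableSet_wrongStream A _ (n + 1) j)
  have hE : expectedSize P₀ P₁ A T ≤ (N + 1 : ℕ) + K := by
    classical
    calc expectedSize P₀ P₁ A T ≤ ∫⁻ ω, ((N + 1 : ℕ) + ∑' n,
          {ω : ∀ j, ℕ → E j | ∃ j, ω j ∈ wrongStream P₀ P₁ I₀ I₁ A (1 - ε) (n + 1) j}.indicator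
            1 ω) ∂(signalLaw P₀ P₁ A) := by
          refine lintegral_mono fun ω => ?_
          refine (toENNReal_le_add_tsum (hgood ω)).trans (le_of_eq ?_)
          refine congrArg _ (tsum_congr fun n => ?_)
          simp [Set.indicator_apply]
      _ = (N + 1 : ℕ) + K := by
          rw [lintegral_add_left measurable_const, lintegral_const, measure_univ, mul_one,
            lintegral_tsum fun n => (measurable_one.indicator (hmeas n)).aemeasurable]
          congr 1
          exact tsum_congr fun n => lintegral_indicator_one (hmeas n)
  have hN : ((N + 1 : ℕ) : ℝ≥0∞) ≤ ENNReal.ofReal M + 2 := by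
    have h1 : ((N + 1 : ℕ) : ℝ) ≤ M + 2 := by
      have := Nat.ceil_lt_add_one hM0
      push_cast
      linarith
    calc ((N + 1 : ℕ) : ℝ≥0∞) = ENNReal.ofReal ((N + 1 : ℕ) : ℝ) := (ENNReal.ofReal_natCast _).symm
      _ ≤ ENNReal.ofReal (M + 2) := ENNReal.ofReal_le_ofReal h1
      _ = ENNReal.ofReal M + 2 := by
          rw [ENNReal.ofReal_add hM0 zero_le_two]
          simp
  rw [ENNReal.div_le_iff_le_mul (Or.inl (ENNReal.ofReal_pos.2 hε0).ne')
    (Or.inl ENNReal.ofReal_ne_top)] at hp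
  calc expectedSize P₀ P₁ A T ≤ (N + 1 : ℕ) + K := hE
    _ ≤ ENNReal.ofReal M + 2 + K := by gcongr
    _ = ENNReal.ofReal ((1 + ε) / (1 - ε)) * X + (2 + K) := by rw [hMX, add_assoc]
    _ ≤ ENNReal.ofReal ((1 + ε) / (1 - ε)) * X + X * ENNReal.ofReal ε := by gcongr
    _ = ENNReal.ofReal ((1 + ε) / (1 - ε) + ε) * X := by
        rw [ENNReal.ofReal_add (by positivity) hε0.le]
        ring
    _ ≤ ENNReal.ofReal (1 + η) * X := by gcongr

lemma eventually_expectedSize_leapTime_le (hequiv : ∀ j, LocallyEquivalent (P₀ j) (P₁ j))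
    (hI₀ : ∀ j, 0 < I₀ j) (hI₁ : ∀ j, 0 < I₁ j)
    (hstream : ∀ j, StreamAssumption (P₀ j) (P₁ j) (I₀ j) (I₁ j))
    (hk₁ : 1 ≤ k₁) (hk₂ : 1 ≤ k₂) (hk : k₁ + k₂ ≤ J) {a b : ℝ → ℝ → ℝ}
    (ha : Tendsto (fun p : ℝ × ℝ => a p.1 p.2 / |Real.log p.2|) toZero (𝓝 1))
    (hb : Tendsto (fun p : ℝ × ℝ => b p.1 p.2 / |Real.log p.1|) toZero (𝓝 1))
    (A : Finset (Fin J)) {η : ℝ} (hη : 0 < η) :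
    ∀ᶠ p in toZero, expectedSize P₀ P₁ A (leapTime P₀ P₁ k₁ k₂ (a p.1 p.2) (b p.1 p.2)) ≤
      ENNReal.ofReal (1 + η) * limitSize I₀ I₁ k₁ k₂ A p.1 p.2 := by
  have h1 : ∀ᶠ p in toZero, ∀ ℓ ∈ Finset.Ico 0 k₁,
      expectedSize P₀ P₁ A (leapTime P₀ P₁ k₁ k₂ (a p.1 p.2) (b p.1 p.2)) ≤
        ENNReal.ofReal (1 + η) * LHat I₀ I₁ k₁ k₂ A p.1 p.2 ℓ := by
    refine (Finset.eventually_all _).2 fun ℓ hℓ => ?_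
    have hℓ' := Finset.mem_Ico.1 hℓ
    filter_upwards [eventually_expectedSize_le_maxRatio hequiv hI₀ hI₁ hstream A ha hb
      (ℓ₁ := 1) (u₁ := k₁ - ℓ) (ℓ₀ := ℓ + 1) (u₀ := ℓ + k₂) le_rfl (by omega) (by omega) (by omega)
      (infoSum_ne_top_or hk (by omega)) hη] with p hp
    refine hp _ fun ω n hn hpos hneg => ?_
    exact (min_le_left _ _).trans ((iInf₂_le ℓ hℓ).trans (iInf₂_le n ⟨hn, hpos, hneg⟩))
  have h2 : ∀ᶠ p in toZero, ∀ ℓ ∈ Finset.Ico 1 k₂,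
      expectedSize P₀ P₁ A (leapTime P₀ P₁ k₁ k₂ (a p.1 p.2) (b p.1 p.2)) ≤
        ENNReal.ofReal (1 + η) * LCheck I₀ I₁ k₁ k₂ A p.1 p.2 ℓ := by
    refine (Finset.eventually_all _).2 fun ℓ hℓ => ?_
    have hℓ' := Finset.mem_Ico.1 hℓ
    filter_upwards [eventually_expectedSize_le_maxRatio hequiv hI₀ hI₁ hstream A ha hb
      (ℓ₁ := ℓ + 1) (u₁ := ℓ + k₁) (ℓ₀ := 1) (u₀ := k₂ - ℓ) (by omega) (by omega) le_rfl (by omega)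
      (infoSum_ne_top_or hk (by omega)) hη] with p hp
    refine hp _ fun ω n hn hpos hneg => ?_
    exact (min_le_right _ _).trans ((iInf₂_le ℓ hℓ).trans (iInf₂_le n ⟨hn, hpos, hneg⟩))
  filter_upwards [h1, h2] with p hp1 hp2
  exact le_mul_limitSize hk₁ hp1 hp2 (ENNReal.ofReal_pos.2 (by linarith)).ne'
    ENNReal.ofReal_ne_top

end Bounds

section LowerBound

variable {J : ℕ} {E : Fin J → Type*} [∀ j, MeasurableSpace (E j)]
  {P₀ P₁ : ∀ j : Fin J, Measure (ℕ → E j)}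
  [∀ j, IsProbabilityMeasure (P₀ j)] [∀ j, IsProbabilityMeasure (P₁ j)]
  {I₀ I₁ : Fin J → ℝ} {k₁ k₂ : ℕ}

/-! ### Lower bound for the expected sample size -/

/-- The rate of growth of the log-likelihood ratio of `P_A` against `P_C` under `P_A`. -/
def infoDistance (I₀ I₁ : Fin J → ℝ) (A C : Finset (Fin J)) : ℝ :=
  ∑ j ∈ A \ C, I₁ j + ∑ j ∈ C \ A, I₀ j

/-- Streams outside the symmetric difference of A and C have the same law under both hypotheses and
contribute nothing to the likelihood ratio. -/
lemma exists_bound_early_decision_signalLaw (hequiv : ∀ j, LocallyEquivalent (P₀ j) (P₁ j))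
    (hstream : ∀ j, StreamAssumption (P₀ j) (P₁ j) (I₀ j) (I₁ j)) (A C : Finset (Fin J))
    (hpos : 0 < infoDistance I₀ I₁ A C) {ε : ℝ} (hε0 : 0 < ε) (hε1 : ε < 1) :
    ∃ g : ℝ → ℝ≥0∞, Tendsto g (𝓝[>] 0) (𝓝 0) ∧
      ∀ (T : (∀ j, ℕ → E j) → ℕ∞) (hT : IsStoppingTime (ι := ℕ) (obsFiltration E) T)
        (H : Set (∀ j, ℕ → E j)) (_ : MeasurableSet[hT.measurableSpace] H)
        (α : ℝ) (_ : 0 < α) (_ : α < 1) (_ : signalLaw P₀ P₁ C H ≤ ENNReal.ofReal α)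
        (m : ℕ) (_ : (m : ℝ) ≤ (1 - ε) * |Real.log α| / infoDistance I₀ I₁ A C),
        signalLaw P₀ P₁ A (H ∩ {ω | T ω ≤ m}) ≤ g α := by
  have hsum : ∑ j, (if j ∈ A then (if j ∈ C then 0 else I₁ j) else (if j ∈ C then I₀ j else 0)) =
      infoDistance I₀ I₁ A C := by
    unfold infoDistance
    rw [← Finset.sum_filter_add_sum_filter_not Finset.univ (· ∈ A)]
    congr 1
    · rw [Finset.sum_congr rfl fun j hj => if_pos (Finset.mem_filter.1 hj).2,
        Finset.sum_congr rfl fun j _ => (ite_not (j ∈ C) (I₁ j) 0).symm, ← Finset.sum_filter]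
      congr 1
      ext j
      simp
    · rw [Finset.sum_congr rfl fun j hj => if_neg (Finset.mem_filter.1 hj).2,
        ← Finset.sum_filter]
      congr 1
      ext j
      simp [and_comm]
  have hself : ∀ {j : Fin J} (P : Measure (ℕ → E j)) [IsProbabilityMeasure P],
      ∀ᵐ x ∂P, Tendsto (fun n : ℕ => logLR P P n x / n) atTop (𝓝 0) := by
    intro j P _
    filter_upwards [ae_all_iff.2 fun n => logLR_self (P₀ := P) n] with x hx
    simp [hx]
  have := exists_bound_early_decision (fun j => if j ∈ C then P₁ j else P₀ j)
    (fun j => if j ∈ A then P₁ j else P₀ j) ?_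
    (K := fun j => if j ∈ A then (if j ∈ C then 0 else I₁ j) else (if j ∈ C then I₀ j else 0))
    ?_ (by rwa [hsum]) hε0 hε1
  · rw [hsum] at this
    exact this
  · intro j
    by_cases hC : j ∈ C <;> by_cases hA : j ∈ A <;> simp only [hC, hA, if_true, if_false]
    · exact fun n => ⟨Measure.AbsolutelyContinuous.rfl, Measure.AbsolutelyContinuous.rfl⟩
    · exact (hequiv j).symm
    · exact hequiv j
    · exact fun n => ⟨Measure.AbsolutelyContinuous.rfl, Measure.AbsolutelyContinuous.rfl⟩
  · intro j
    by_cases hC : j ∈ C <;> by_cases hA : j ∈ A <;> simp only [hC, hA, if_true, if_false]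
    · exact hself _
    · exact ((hstream j).swap (hequiv j)).ae_tendsto
    · exact (hstream j).ae_tendsto
    · exact hself _

lemma measurableSet_decision_eq {T : (∀ j, ℕ → E j) → ℕ∞} {D : (∀ j, ℕ → E j) → Finset (Fin J)}
    {hT : IsStoppingTime (ι := ℕ) (obsFiltration E) T}
    (hD : ∀ j : Fin J, MeasurableSet[hT.measurableSpace] {ω | j ∈ D ω}) (B : Finset (Fin J)) :
    MeasurableSet[hT.measurableSpace] {ω | D ω = B} := by
  have h : {ω | D ω = B} = ⋂ j, {ω | j ∈ D ω ↔ j ∈ B} := by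
    ext ω
    simp [Finset.ext_iff]
  rw [h]
  refine MeasurableSet.iInter fun j => ?_
  by_cases hj : j ∈ B
  · simpa [hj] using hD j
  · have h' : {ω | j ∈ D ω ↔ j ∈ B} = {ω | j ∈ D ω}ᶜ := by
      ext ω
      simp [hj]
    exact h' ▸ (hD j).compl

lemma nat_le_of_le_mul_div {ε c I : ℝ} {D L : ℝ≥0∞} {m : ℕ} (hε : ε < 1) (hc : 0 ≤ c) (hI : 0 < I)
    (hID : ENNReal.ofReal I ≤ D) (hL : L ≤ ENNReal.ofReal c / D)
    (hm : (m : ℝ≥0∞) ≤ ENNReal.ofReal (1 - ε) * L) : (m : ℝ) ≤ (1 - ε) * c / I := by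
  have h : (m : ℝ≥0∞) ≤ ENNReal.ofReal ((1 - ε) * c / I) := by
    calc (m : ℝ≥0∞) ≤ ENNReal.ofReal (1 - ε) * (ENNReal.ofReal c / ENNReal.ofReal I) := by
          refine hm.trans ?_
          gcongr
          exact hL.trans (ENNReal.div_le_div_left hID _)
      _ = ENNReal.ofReal ((1 - ε) * c / I) := by
          rw [← ENNReal.ofReal_div_of_pos hI, ← ENNReal.ofReal_mul (by linarith), mul_div_assoc]
  have h1ε : 0 ≤ 1 - ε := by linarith
  rw [← ENNReal.ofReal_natCast] at h
  exact (ENNReal.ofReal_le_ofReal_iff (by positivity)).1 h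

lemma ofReal_sum_eq {S : Finset (Fin J)} {I : Fin J → ℝ} (hI : ∀ j, 0 < I j) :
    ENNReal.ofReal (∑ j ∈ S, I j) = ∑ j ∈ S, ENNReal.ofReal (I j) :=
  ENNReal.ofReal_sum_of_nonneg fun j _ => (hI j).le

/-- A correct decision `B` (up to fewer than `k₁` false positives and `k₂` false negatives) is
unlikely to be reached before time `(1 - ε) L_A`. -/
lemma exists_bound_early_decision_eq (hequiv : ∀ j, LocallyEquivalent (P₀ j) (P₁ j))
    (hI₀ : ∀ j, 0 < I₀ j) (hI₁ : ∀ j, 0 < I₁ j)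
    (hstream : ∀ j, StreamAssumption (P₀ j) (P₁ j) (I₀ j) (I₁ j)) (A B : Finset (Fin J))
    (hs : (B \ A).card < k₁) (hr : (A \ B).card < k₂) {ε : ℝ} (hε0 : 0 < ε) (hε1 : ε < 1) :
    ∃ g : ℝ × ℝ → ℝ≥0∞, Tendsto g toZero (𝓝 0) ∧
      ∀ p : ℝ × ℝ, 0 < p.1 → p.1 < 1 → 0 < p.2 → p.2 < 1 →
        ∀ (T : (∀ j, ℕ → E j) → ℕ∞) (D : (∀ j, ℕ → E j) → Finset (Fin J))
          (_ : InClass P₀ P₁ k₁ k₂ p.1 p.2 T D) (m : ℕ)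
          (_ : (m : ℝ≥0∞) ≤ ENNReal.ofReal (1 - ε) * limitSize I₀ I₁ k₁ k₂ A p.1 p.2),
          signalLaw P₀ P₁ A ({ω | D ω = B} ∩ {ω | T ω ≤ m}) ≤ g p := by
  set s := (B \ A).card with hsdef
  set r := (A \ B).card with hrdef
  set D₁ := infoSum I₁ A (r + 1) (r + (k₁ - s)) with hD₁
  set D₀ := infoSum I₀ Aᶜ (s + 1) (s + (k₂ - r)) with hD₀
  obtain ⟨g₁, hg₁, hb₁⟩ : ∃ g : ℝ → ℝ≥0∞, Tendsto g (𝓝[>] 0) (𝓝 0) ∧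
      (D₁ ≠ ∞ → ∀ p : ℝ × ℝ, 0 < p.1 → p.1 < 1 →
        ∀ (T : (∀ j, ℕ → E j) → ℕ∞) (D : (∀ j, ℕ → E j) → Finset (Fin J))
          (_ : InClass P₀ P₁ k₁ k₂ p.1 p.2 T D) (L : ℝ≥0∞)
          (_ : L ≤ ENNReal.ofReal |Real.log p.1| / D₁) (m : ℕ)
          (_ : (m : ℝ≥0∞) ≤ ENNReal.ofReal (1 - ε) * L),
          signalLaw P₀ P₁ A ({ω | D ω = B} ∩ {ω | T ω ≤ m}) ≤ g p.1) := by
    by_cases htop : D₁ = ∞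
    · exact ⟨0, tendsto_const_nhds, fun h => absurd htop h⟩
    -- U is chosen inside A ∩ B; removing its signals adds k₁ - s false positives to the s already
    -- in B \ A.
    obtain ⟨U, hUG, hUA, hUc, hU⟩ := exists_subset_sum_le (S := A) (G := A ∩ B) (r := r)
      (by simp [hrdef]) (k₁ - s) htop
    have hdist : infoDistance I₀ I₁ A (A \ U) = ∑ j ∈ U, I₁ j := by
      unfold infoDistance
      rw [Finset.sdiff_sdiff_eq_self hUA,
        Finset.sdiff_eq_empty_iff_subset.2 Finset.sdiff_subset, Finset.sum_empty, add_zero]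
    have hUpos : 0 < ∑ j ∈ U, I₁ j :=
      Finset.sum_pos (fun j _ => hI₁ j) (Finset.card_pos.1 (by omega))
    obtain ⟨g, hg, hb⟩ := exists_bound_early_decision_signalLaw hequiv hstream A (A \ U)
      (hdist ▸ hUpos) hε0 hε1
    refine ⟨g, hg, fun _ p hp0 hp1 T D hTD L hL m hm => ?_⟩
    obtain ⟨⟨-, hT, hD⟩, herr⟩ := hTD
    refine hb T hT _ (measurableSet_decision_eq hD B) p.1 hp0 hp1 ?_ m ?_
    · refine le_trans (measure_mono fun ω (hω : D ω = B) => ?_) (herr (A \ U)).1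
      change k₁ ≤ (D ω \ (A \ U)).card
      rw [hω]
      have hdisj : Disjoint (B \ A) U :=
        Finset.disjoint_left.2 fun j hj hjU => (Finset.mem_sdiff.1 hj).2 (hUA hjU)
      calc k₁ ≤ ((B \ A) ∪ U).card := by
            rw [Finset.card_union_of_disjoint hdisj]
            omega
        _ ≤ (B \ (A \ U)).card := by
            refine Finset.card_le_card fun j hj => ?_
            rcases Finset.mem_union.1 hj with h | h
            · simp only [Finset.mem_sdiff] at h ⊢
              exact ⟨h.1, fun h' => h.2 h'.1⟩
            · have := (Finset.mem_inter.1 (hUG h)).2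
              simp only [Finset.mem_sdiff]
              exact ⟨this, fun h' => h'.2 h⟩
    · rw [hdist]
      exact nat_le_of_le_mul_div hε1 (abs_nonneg _) hUpos
        ((ofReal_sum_eq hI₁).trans_le hU) hL hm
  obtain ⟨g₀, hg₀, hb₀⟩ : ∃ g : ℝ → ℝ≥0∞, Tendsto g (𝓝[>] 0) (𝓝 0) ∧
      (D₀ ≠ ∞ → ∀ p : ℝ × ℝ, 0 < p.2 → p.2 < 1 →
        ∀ (T : (∀ j, ℕ → E j) → ℕ∞) (D : (∀ j, ℕ → E j) → Finset (Fin J))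
          (_ : InClass P₀ P₁ k₁ k₂ p.1 p.2 T D) (L : ℝ≥0∞)
          (_ : L ≤ ENNReal.ofReal |Real.log p.2| / D₀) (m : ℕ)
          (_ : (m : ℝ≥0∞) ≤ ENNReal.ofReal (1 - ε) * L),
          signalLaw P₀ P₁ A ({ω | D ω = B} ∩ {ω | T ω ≤ m}) ≤ g p.2) := by
    by_cases htop : D₀ = ∞
    · exact ⟨0, tendsto_const_nhds, fun h => absurd htop h⟩
    have hG : Aᶜ \ (Aᶜ \ B) = B \ A := by
      ext j
      simp
      tauto
    -- U is chosen outside A ∪ B; adding its signals brings the number of false negatives of B from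
    -- r to k₂.
    obtain ⟨U, hUG, hUA, hUc, hU⟩ := exists_subset_sum_le (S := Aᶜ) (G := Aᶜ \ B) (r := s)
      (by rw [hG]) (k₂ - r) htop
    have hdisjA : Disjoint U A :=
      Finset.disjoint_left.2 fun j hj hjA => Finset.mem_compl.1 (hUA hj) hjA
    have hdist : infoDistance I₀ I₁ A (A ∪ U) = ∑ j ∈ U, I₀ j := by
      unfold infoDistance
      rw [Finset.sdiff_eq_empty_iff_subset.2 Finset.subset_union_left, Finset.sum_empty, zero_add,
        Finset.union_sdiff_cancel_left hdisjA.symm]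
    have hUpos : 0 < ∑ j ∈ U, I₀ j :=
      Finset.sum_pos (fun j _ => hI₀ j) (Finset.card_pos.1 (by omega))
    obtain ⟨g, hg, hb⟩ := exists_bound_early_decision_signalLaw hequiv hstream A (A ∪ U)
      (hdist ▸ hUpos) hε0 hε1
    refine ⟨g, hg, fun _ p hp0 hp1 T D hTD L hL m hm => ?_⟩
    obtain ⟨⟨-, hT, hD⟩, herr⟩ := hTD
    refine hb T hT _ (measurableSet_decision_eq hD B) p.2 hp0 hp1 ?_ m ?_
    · refine le_trans (measure_mono fun ω (hω : D ω = B) => ?_) (herr (A ∪ U)).2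
      change k₂ ≤ ((A ∪ U) \ D ω).card
      rw [hω]
      have hdisj : Disjoint (A \ B) U :=
        Finset.disjoint_left.2 fun j hj hjU =>
          Finset.disjoint_left.1 hdisjA hjU (Finset.mem_sdiff.1 hj).1
      calc k₂ ≤ ((A \ B) ∪ U).card := by
            rw [Finset.card_union_of_disjoint hdisj]
            omega
        _ ≤ ((A ∪ U) \ B).card := by
            refine Finset.card_le_card fun j hj => ?_
            rw [Finset.mem_sdiff, Finset.mem_union]
            rcases Finset.mem_union.1 hj with h | h
            · exact ⟨Or.inl (Finset.mem_sdiff.1 h).1, (Finset.mem_sdiff.1 h).2⟩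
            · exact ⟨Or.inr h, (Finset.mem_sdiff.1 (hUG h)).2⟩
    · rw [hdist]
      exact nat_le_of_le_mul_div hε1 (abs_nonneg _) hUpos
        ((ofReal_sum_eq hI₀).trans_le hU) hL hm
  refine ⟨fun p => g₁ p.1 + g₀ p.2, ?_, ?_⟩
  · simpa using (hg₁.comp tendsto_fst_toZero).add (hg₀.comp tendsto_snd_toZero)
  · intro p hp0 hp1 hq0 hq1 T D hTD m hm
    -- For m = 0 the event is empty because T ≥ 1. For m > 0 the hypothesis on m forces L ≠ 0, which
    -- rules out an infinite denominator in whichever ratio dominates L.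
    rcases Nat.eq_zero_or_pos m with rfl | hmpos
    · have hempty : ({ω | D ω = B} ∩ {ω | T ω ≤ (0 : ℕ)}) = ∅ := by
        refine Set.eq_empty_of_forall_notMem fun ω hω => ?_
        have h0 : T ω ≤ (0 : ℕ) := hω.2
        simpa using (hTD.1.1 ω).trans h0
      rw [hempty]
      simp
    set L := limitSize I₀ I₁ k₁ k₂ A p.1 p.2
    have hL0 : L ≠ 0 := by
      intro h0
      rw [h0, mul_zero] at hm
      have : (m : ℝ≥0∞) = 0 := le_antisymm hm zero_le
      have : m = 0 := by exact_mod_cast this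
      omega
    have hLmax : L ≤ maxRatio D₁ D₀ p.1 p.2 := limitSize_le_maxRatio hs hr
    have hne : ∀ {c D : ℝ≥0∞}, L ≤ c / D → D ≠ ∞ := by
      rintro c D h rfl
      rw [ENNReal.div_top] at h
      exact hL0 (le_antisymm h zero_le)
    rcases le_max_iff.1 hLmax with h | h
    · exact (hb₁ (hne h) p hp0 hp1 T D hTD L h m hm).trans le_self_add
    · exact (hb₀ (hne h) p hq0 hq1 T D hTD L h m hm).trans le_add_self

lemma eventually_toZero : ∀ᶠ p : ℝ × ℝ in toZero, (0 < p.1 ∧ p.1 < 1) ∧ 0 < p.2 ∧ p.2 < 1 := by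
  have h : ∀ᶠ x : ℝ in 𝓝[>] 0, 0 < x ∧ x < 1 := Ioo_mem_nhdsGT zero_lt_one
  exact (tendsto_fst_toZero.eventually h).and (tendsto_snd_toZero.eventually h)

/-- A decision with too many errors has probability at most α + β, and each of the finitely many
others is unlikely to come early. So T exceeds (1 - ε) L_A, up to rounding, with probability at
least 1 - ε, and Markov's inequality gives the factor (1 - ε)² ≥ 1 - η for ε = η / 2. All bounds are
uniform over the class. -/
lemma eventually_le_expectedSize (hequiv : ∀ j, LocallyEquivalent (P₀ j) (P₁ j))
    (hI₀ : ∀ j, 0 < I₀ j) (hI₁ : ∀ j, 0 < I₁ j)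
    (hstream : ∀ j, StreamAssumption (P₀ j) (P₁ j) (I₀ j) (I₁ j))
    (hk₁ : 1 ≤ k₁) (hk₂ : 1 ≤ k₂) (A : Finset (Fin J)) {η : ℝ} (hη0 : 0 < η) (hη1 : η < 1) :
    ∀ᶠ p in toZero, ∀ (T : (∀ j, ℕ → E j) → ℕ∞) (D : (∀ j, ℕ → E j) → Finset (Fin J))
      (_ : InClass P₀ P₁ k₁ k₂ p.1 p.2 T D),
      ENNReal.ofReal (1 - η) * limitSize I₀ I₁ k₁ k₂ A p.1 p.2 ≤ expectedSize P₀ P₁ A T := by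
  set ε := η / 2
  have hε0 : 0 < ε := half_pos hη0
  have hε1 : ε < 1 := by simp only [ε]; linarith
  have hex : ∀ B : Finset (Fin J), ∃ g : ℝ × ℝ → ℝ≥0∞, Tendsto g toZero (𝓝 0) ∧
      ((B \ A).card < k₁ → (A \ B).card < k₂ →
      ∀ p : ℝ × ℝ, 0 < p.1 → p.1 < 1 → 0 < p.2 → p.2 < 1 →
        ∀ (T : (∀ j, ℕ → E j) → ℕ∞) (D : (∀ j, ℕ → E j) → Finset (Fin J))
          (_ : InClass P₀ P₁ k₁ k₂ p.1 p.2 T D) (m : ℕ)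
          (_ : (m : ℝ≥0∞) ≤ ENNReal.ofReal (1 - ε) * limitSize I₀ I₁ k₁ k₂ A p.1 p.2),
          signalLaw P₀ P₁ A ({ω | D ω = B} ∩ {ω | T ω ≤ m}) ≤ g p) := by
    intro B
    by_cases h : (B \ A).card < k₁ ∧ (A \ B).card < k₂
    · obtain ⟨g, hg, hb⟩ :=
        exists_bound_early_decision_eq hequiv hI₀ hI₁ hstream A B h.1 h.2 hε0 hε1
      exact ⟨g, hg, fun _ _ => hb⟩
    · exact ⟨0, tendsto_const_nhds, fun h1 h2 => absurd ⟨h1, h2⟩ h⟩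
  choose g hg hb using hex
  have hG : Tendsto (fun p : ℝ × ℝ => ENNReal.ofReal p.1 + ENNReal.ofReal p.2 + ∑ B, g B p)
      toZero (𝓝 0) := by
    have hid : Tendsto (fun x : ℝ => ENNReal.ofReal x) (𝓝[>] 0) (𝓝 0) := by
      rw [← ENNReal.ofReal_zero]
      exact ENNReal.tendsto_ofReal (tendsto_nhdsWithin_of_tendsto_nhds tendsto_id)
    have := ((hid.comp tendsto_fst_toZero).add (hid.comp tendsto_snd_toZero)).add
      (tendsto_finsetSum Finset.univ fun B _ => hg B)
    simpa using this
  filter_upwards [hG.eventually_le_const (ENNReal.ofReal_pos.2 hε0), eventually_toZero]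
    with p hp hp01 T D hTD
  set L := limitSize I₀ I₁ k₁ k₂ A p.1 p.2
  have hLtop : L ≠ ∞ := limitSize_ne_top hI₀ hI₁ hk₁ hk₂
  have h1ε : 0 ≤ 1 - ε := by linarith
  set m := ⌊(1 - ε) * L.toReal⌋₊
  have htL : ENNReal.ofReal ((1 - ε) * L.toReal) = ENNReal.ofReal (1 - ε) * L := by
    rw [ENNReal.ofReal_mul h1ε, ENNReal.ofReal_toReal hLtop]
  have hm : (m : ℝ≥0∞) ≤ ENNReal.ofReal (1 - ε) * L := by
    rw [← htL, ← ENNReal.ofReal_natCast]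
    exact ENNReal.ofReal_le_ofReal (Nat.floor_le (by positivity))
  have hm' : ENNReal.ofReal (1 - ε) * L ≤ ((m + 1 : ℕ) : ℝ≥0∞) := by
    rw [← htL, ← ENNReal.ofReal_natCast]
    refine ENNReal.ofReal_le_ofReal ?_
    push_cast
    exact (Nat.lt_floor_add_one _).le
  have hTmeas : MeasurableSet {ω | T ω ≤ m} := by
    obtain ⟨⟨-, hT, -⟩, -⟩ := hTD
    exact (obsFiltration E).le m _ (hT m)
  have hprob : signalLaw P₀ P₁ A {ω | T ω ≤ m} ≤ ENNReal.ofReal ε := by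
    refine le_trans ?_ hp
    have hsub : {ω | T ω ≤ m} ⊆ ({ω | k₁ ≤ (D ω \ A).card} ∪ {ω | k₂ ≤ (A \ D ω).card}) ∪
        ⋃ B ∈ Finset.univ.filter fun B : Finset (Fin J) => (B \ A).card < k₁ ∧ (A \ B).card < k₂,
          ({ω | D ω = B} ∩ {ω | T ω ≤ m}) := by
      intro ω hω
      by_cases h1 : k₁ ≤ (D ω \ A).card
      · exact Or.inl (Or.inl h1)
      by_cases h2 : k₂ ≤ (A \ D ω).card
      · exact Or.inl (Or.inr h2)
      refine Or.inr (Set.mem_biUnion (x := D ω) ?_ ⟨rfl, hω⟩)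
      simp only [Finset.coe_filter, Finset.mem_univ, true_and, Set.mem_ofPred_eq]
      omega
    refine (measure_mono hsub).trans ((measure_union_le _ _).trans (add_le_add
      ((measure_union_le _ _).trans (add_le_add (hTD.2 A).1 (hTD.2 A).2)) ?_))
    refine (measure_biUnion_finset_le _ _).trans
      ((Finset.sum_le_sum fun B hB => ?_).trans
        (Finset.sum_le_sum_of_subset (Finset.filter_subset _ _)))
    have hB' := (Finset.mem_filter.1 hB).2
    exact hb B hB'.1 hB'.2 p hp01.1.1 hp01.1.2 hp01.2.1 hp01.2.2 T D hTD m hm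
  have hcompl : ENNReal.ofReal (1 - ε) ≤ signalLaw P₀ P₁ A {ω | T ω ≤ m}ᶜ := by
    rw [prob_compl_eq_one_sub hTmeas, ENNReal.ofReal_sub _ hε0.le, ENNReal.ofReal_one]
    exact tsub_le_tsub_left hprob _
  calc ENNReal.ofReal (1 - η) * L ≤ ENNReal.ofReal ((1 - ε) * (1 - ε)) * L := by
        gcongr
        simp only [ε]
        nlinarith
    _ = ENNReal.ofReal (1 - ε) * L * ENNReal.ofReal (1 - ε) := by
        rw [ENNReal.ofReal_mul h1ε]
        ring
    _ ≤ (m + 1 : ℕ) * signalLaw P₀ P₁ A {ω | T ω ≤ m}ᶜ := by gcongr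
    _ = ∫⁻ _ in {ω | T ω ≤ m}ᶜ, ((m + 1 : ℕ) : ℝ≥0∞) ∂(signalLaw P₀ P₁ A) := by
        rw [setLIntegral_const]
    _ ≤ ∫⁻ ω in {ω | T ω ≤ m}ᶜ, ((T ω : ℕ∞) : ℝ≥0∞) ∂(signalLaw P₀ P₁ A) := by
        refine setLIntegral_mono' hTmeas.compl fun ω hω => ?_
        have h1 : (m : ℕ∞) < T ω := not_le.1 hω
        have h2 : ((m + 1 : ℕ) : ℕ∞) ≤ T ω := by
          push_cast
          exact Order.add_one_le_of_lt h1
        exact_mod_cast ENat.toENNReal_le.2 h2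
    _ ≤ expectedSize P₀ P₁ A T := setLIntegral_le_lintegral _ _

end LowerBound

/-! ### From two-sided bounds to the limit of a ratio -/

lemma tendsto_div_one_of_bounds {ι : Type*} {l : Filter ι} {f L : ι → ℝ≥0∞}
    (hL0 : ∀ᶠ i in l, L i ≠ 0) (hLtop : ∀ i, L i ≠ ∞)
    (h : ∀ ε : ℝ, 0 < ε → ε < 1 → ∀ᶠ i in l, ENNReal.ofReal (1 - ε) * L i ≤ f i ∧
      f i ≤ ENNReal.ofReal (1 + ε) * L i) :
    Tendsto (fun i => f i / L i) l (𝓝 1) := by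
  rw [ENNReal.tendsto_nhds ENNReal.one_ne_top]
  intro δ hδ
  obtain ⟨e, he0, heδ⟩ : ∃ e : ℝ, (0 < e ∧ e < 1) ∧ ENNReal.ofReal e ≤ δ := by
    obtain ⟨q, hq0, hq⟩ := ENNReal.lt_iff_exists_real_btwn.1 (lt_min hδ zero_lt_one)
    have h1 : 0 < q := ENNReal.ofReal_pos.1 hq.1
    refine ⟨q, ⟨h1, ?_⟩, (hq.2.trans_le (min_le_left _ _)).le⟩
    have := hq.2.trans_le (min_le_right _ _)
    rwa [← ENNReal.ofReal_one, ENNReal.ofReal_lt_ofReal_iff zero_lt_one] at this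
  filter_upwards [h e he0.1 he0.2, hL0] with i hi h0
  constructor
  · rw [ENNReal.le_div_iff_mul_le (Or.inl h0) (Or.inl (hLtop i))]
    refine le_trans ?_ hi.1
    gcongr
    rw [ENNReal.ofReal_sub _ he0.1.le, ENNReal.ofReal_one]
    exact tsub_le_tsub_left heδ _
  · rw [ENNReal.div_le_iff_le_mul (Or.inl h0) (Or.inl (hLtop i))]
    refine hi.2.trans ?_
    gcongr
    rw [ENNReal.ofReal_add zero_le_one he0.1.le, ENNReal.ofReal_one]
    gcongr

end GFWER

theorem theorem4p2 {J : ℕ} {E : Fin J → Type*} [∀ j, MeasurableSpace (E j)]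
    (P₀ P₁ : ∀ j : Fin J, Measure (ℕ → E j))
    [∀ j, IsProbabilityMeasure (P₀ j)] [∀ j, IsProbabilityMeasure (P₁ j)]
    (hequiv : ∀ j, GFWER.LocallyEquivalent (P₀ j) (P₁ j))
    (I₀ I₁ : Fin J → ℝ) (hI₀ : ∀ j, 0 < I₀ j) (hI₁ : ∀ j, 0 < I₁ j)
    (hstream : ∀ j, GFWER.StreamAssumption (P₀ j) (P₁ j) (I₀ j) (I₁ j))
    (k₁ k₂ : ℕ) (hk₁ : 1 ≤ k₁) (hk₂ : 1 ≤ k₂) (hk : k₁ + k₂ ≤ J)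
    -- the thresholds of the Leap rule, as functions of the levels `α` and `β`
    (a b : ℝ → ℝ → ℝ)
    (hclass : ∀ᶠ p : ℝ × ℝ in GFWER.toZero,
      GFWER.InClass P₀ P₁ k₁ k₂ p.1 p.2
        (GFWER.leapTime P₀ P₁ k₁ k₂ (a p.1 p.2) (b p.1 p.2))
        (GFWER.leapDecision P₀ P₁ k₁ k₂ (a p.1 p.2) (b p.1 p.2)))
    (ha : Tendsto (fun p : ℝ × ℝ => a p.1 p.2 / |Real.log p.2|) GFWER.toZero (𝓝 1))
    (hb : Tendsto (fun p : ℝ × ℝ => b p.1 p.2 / |Real.log p.1|) GFWER.toZero (𝓝 1))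
    (A : Finset (Fin J)) :
    Tendsto (fun p : ℝ × ℝ =>
        GFWER.expectedSize P₀ P₁ A
          (GFWER.leapTime P₀ P₁ k₁ k₂ (a p.1 p.2) (b p.1 p.2)) /
        GFWER.limitSize I₀ I₁ k₁ k₂ A p.1 p.2) GFWER.toZero (𝓝 1) ∧
    Tendsto (fun p : ℝ × ℝ =>
        GFWER.limitSize I₀ I₁ k₁ k₂ A p.1 p.2 /
        GFWER.optimalSize P₀ P₁ k₁ k₂ A p.1 p.2) GFWER.toZero (𝓝 1) := by
  have hlow := fun (ε : ℝ) (hε0 : 0 < ε) (hε1 : ε < 1) =>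
    GFWER.eventually_le_expectedSize hequiv hI₀ hI₁ hstream hk₁ hk₂ A hε0 hε1
  have hup := fun (ε : ℝ) (hε0 : 0 < ε) =>
    GFWER.eventually_expectedSize_leapTime_le hequiv hI₀ hI₁ hstream hk₁ hk₂ hk ha hb A hε0
  have hL0 : ∀ᶠ p in GFWER.toZero, GFWER.limitSize I₀ I₁ k₁ k₂ A p.1 p.2 ≠ 0 :=
    GFWER.eventually_limitSize_ne_zero hk₁ hk
  have hLtop : ∀ p : ℝ × ℝ, GFWER.limitSize I₀ I₁ k₁ k₂ A p.1 p.2 ≠ ∞ := fun p =>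
    GFWER.limitSize_ne_top hI₀ hI₁ hk₁ hk₂
  refine ⟨GFWER.tendsto_div_one_of_bounds hL0 hLtop fun ε hε0 hε1 => ?_, ?_⟩
  · filter_upwards [hlow ε hε0 hε1, hup ε hε0, hclass] with p h1 h2 h3
    exact ⟨h1 _ _ h3, h2⟩
  · have hopt := GFWER.tendsto_div_one_of_bounds
      (f := fun p : ℝ × ℝ => GFWER.optimalSize P₀ P₁ k₁ k₂ A p.1 p.2) hL0 hLtop
      fun ε hε0 hε1 => by
        filter_upwards [hlow ε hε0 hε1, hup ε hε0, hclass] with p h1 h2 h3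
        refine ⟨le_iInf fun T => le_iInf fun D => le_iInf fun h => h1 T D h, le_trans ?_ h2⟩
        exact (iInf_le _ _).trans ((iInf_le _ _).trans (iInf_le _ h3))
    -- The squeeze controls N*_A / L_A; inverting the ratio is legitimate because L_A is finite and
    -- eventually nonzero.
    have hinv := hopt.inv
    rw [inv_one] at hinv
    refine hinv.congr' ?_
    filter_upwards [hL0] with p hp
    exact ENNReal.inv_div (Or.inl (hLtop p)) (Or.inl hp)
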